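/- All objects are smooth. For a distribution $\Delta$ on a manifold $M$ let $\Delta_1=\Delta$, $\Delta_{i+1}=\Delta_i+[\Delta,\Delta_i]$ be its weak derived flag; its growth vector is $(\dim\Delta_1,\dim\Delta_2/\Delta_1,\dim\Delta_3/\Delta_2,\dots)$. A finite-dimensional graded real Lie algebra $\mathfrak m=\bigoplus_{i\ge1}\mathfrak g_{-i}$ is a fundamental graded nilpotent Lie algebra if $\mathfrak g_{-1}$ generates it; its standard model is the simply connected Lie group of $\mathfrak m$ with the left-invariant distribution defined by $\mathfrak g_{-1}$. The distribution $\Delta$ is flat if, for some fundamental graded nilpotent $\mathfrak m$, it is near every point locally diffeomorphic to the standard model of $\mathfrak m$. An integrable extension of $(M,\Delta)$ is a surjective submersion $\pi:\tilde M\to M$ with a distribution $\tilde\Delta$ on $\tilde M$ such that $d_x\pi:\tilde\Delta_x\to\Delta_{\pi(x)}$ is an isomorphism for all $x\in\tilde M$ and $\tilde\Delta_2\cap\ker d\pi=0$. It is non-trivial if $\tilde\Delta$ is completely non-holonomic ($\tilde\Delta_k=T\tilde M$ for some $k$), and its fibres have pure grading $-k$ if $\ker d\pi\subset\tilde\Delta_k$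 and $\ker d\pi\cap\tilde\Delta_{k-1}=0$. The Monge equation $y^{(m)}=F(x,y,\dots,y^{(m-1)},z,\dots,z^{(n)})$ defines the rank 2 distribution $\langle \partial_x+\sum_{i<m-1}y_{i+1}\partial_{y_i}+F\,\partial_{y_{m-1}}+\sum_{j<n}z_{j+1}\partial_{z_j},\ \partial_{z_n}\rangle$ on an open subset of $\mathbb R^{m+n+2}(x,y_0,\dots,y_{m-1},z_0,\dots,z_n)$. The underdetermined ODE system $u_i'=G_i(x,u_1,\dots,u_N,w)$, $1\le i\le N$, defines the rank 2 distribution $\langle\partial_x+\sum_iG_i\partial_{u_i},\ \partial_w\rangle$ on an open subset of $\mathbb R^{N+2}(x,u_1,\dots,u_N,w)$. **Theorem.** (a) Let $\Delta$ be a flat rank 2 distribution with growth vector $(2,1,2,\dots)$ on a manifold $M$. Then there are distributions $D_0,\dots,D_r$ on $\mathbb R^{d_0},\dots,\mathbb R^{d_r}$, $5=d_0<d_1<\dots<d_r$, such that $D_0$ is the distribution of the Hilbert–Cartan equation $y'=(z'')^2$; each $D_{i+1}$ has rank 2, is flat, and is a non-trivial integrable extension of $D_i$ with fibres of pure grading $-k_i$,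 $k_i>3$; and $\Delta$ is near every point of $M$ locally diffeomorphic to $D_r$. In particular the conclusion of (a) holds in the following two cases. (b) $\Delta$ is the distribution of a single Monge equation as above with $0<m\le n$, $(m,n)\ne(1,1)$, that is non-degenerate ($F_{z^{(n)}z^{(n)}}\ne0$ everywhere on its domain), and $\Delta$ is flat. (c) $\Delta$ is the distribution of an underdetermined ODE system as above, and $\Delta$ is flat with growth vector $(2,1,2,\dots)$. -/

import Mathlib

open scoped Manifold ContDiff Topology

noncomputable section

namespace Monge

/-! ### Distributions on manifolds, their weak derived flags, integrable extensions -/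

section Manifolds

variable {E : Type*} [NormedAddCommGroup E] [NormedSpace ℝ E]
  {M : Type*} [TopologicalSpace M] [ChartedSpace E M] [IsManifold 𝓘(ℝ, E) ∞ M]
  {E' : Type*} [NormedAddCommGroup E'] [NormedSpace ℝ E']
  {M' : Type*} [TopologicalSpace M'] [ChartedSpace E' M'] [IsManifold 𝓘(ℝ, E') ∞ M']

/-- The vector field `X` is smooth on the set `U`. -/
def SmoothOn (X : ∀ y : M, TangentSpace 𝓘(ℝ, E) y) (U : Set M) : Prop :=
  ContMDiffOn 𝓘(ℝ, E) (𝓘(ℝ, E)).tangent ∞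
    (fun y => (⟨y, X y⟩ : TangentBundle 𝓘(ℝ, E) M)) U

/-- `Δ` is a smooth distribution of rank `r`: a field of tangent subspaces which is locally spanned
by `r` smooth, pointwise linearly independent vector fields. -/
def IsDistribution (Δ : ∀ x : M, Submodule ℝ (TangentSpace 𝓘(ℝ, E) x)) (r : ℕ) : Prop :=
  ∀ p : M, ∃ U : Set M, IsOpen U ∧ p ∈ U ∧
    ∃ X : Fin r → ∀ y : M, TangentSpace 𝓘(ℝ, E) y,
      (∀ j, SmoothOn (X j) U) ∧
      ∀ y ∈ U, LinearIndependent ℝ (fun j => X j y) ∧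
        Δ y = Submodule.span ℝ (Set.range fun j => X j y)

/-- `X` restricts to a smooth section of `Δ` over some open neighbourhood of `x`. -/
def IsLocalSection (Δ : ∀ x : M, Submodule ℝ (TangentSpace 𝓘(ℝ, E) x)) (x : M)
    (X : ∀ y : M, TangentSpace 𝓘(ℝ, E) y) : Prop :=
  ∃ U : Set M, IsOpen U ∧ x ∈ U ∧ SmoothOn X U ∧ ∀ y ∈ U, X y ∈ Δ y

/-- The weak derived flag: `Δ₁ = Δ`, and `Δ_{i+1}` is spanned by `Δ_i` and by the brackets
`[X, Y]` of local sections `X` of `Δ` and `Y` of `Δ_i` (and `Δ₀ = 0`). -/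
def weakFlag (Δ : ∀ x : M, Submodule ℝ (TangentSpace 𝓘(ℝ, E) x)) :
    ℕ → ∀ x : M, Submodule ℝ (TangentSpace 𝓘(ℝ, E) x)
  | 0 => fun _ => ⊥
  | 1 => Δ
  | i + 2 => fun x => weakFlag Δ (i + 1) x ⊔ Submodule.span ℝ
      {v | ∃ X Y : ∀ y : M, TangentSpace 𝓘(ℝ, E) y,
        IsLocalSection Δ x X ∧ IsLocalSection (weakFlag Δ (i + 1)) x Y ∧
        v = VectorField.mlieBracket 𝓘(ℝ, E) X Y x}

/-- The growth vector `(dim Δ₁, dim Δ₂/Δ₁, dim Δ₃/Δ₂, …)` starts with `(2, 1, 2, …)` at every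
point of `W`. -/
def HasGrowthTwoOneTwoOn (Δ : ∀ x : M, Submodule ℝ (TangentSpace 𝓘(ℝ, E) x)) (W : Set M) : Prop :=
  ∀ x ∈ W, Module.finrank ℝ (weakFlag Δ 1 x) = 2 ∧
    Module.finrank ℝ (weakFlag Δ 2 x) = 2 + 1 ∧
    Module.finrank ℝ (weakFlag Δ 3 x) = 2 + 1 + 2

/-- `Δ` is completely non-holonomic: some member of the weak derived flag is the whole tangent
bundle. -/
def CompletelyNonholonomic (Δ : ∀ x : M, Submodule ℝ (TangentSpace 𝓘(ℝ, E) x)) : Prop :=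
  ∃ k : ℕ, ∀ x, weakFlag Δ k x = ⊤

/-- A smooth diffeomorphism from an open neighbourhood of `p` onto an open subset of `M'`
carries `Δ` to `Δ'`. -/
def LocallyEquivalentAt (Δ : ∀ x : M, Submodule ℝ (TangentSpace 𝓘(ℝ, E) x)) (p : M)
    (Δ' : ∀ x : M', Submodule ℝ (TangentSpace 𝓘(ℝ, E') x)) : Prop :=
  ∃ φ : OpenPartialHomeomorph M M', p ∈ φ.source ∧
    ContMDiffOn 𝓘(ℝ, E) 𝓘(ℝ, E') ∞ φ φ.source ∧
    ContMDiffOn 𝓘(ℝ, E') 𝓘(ℝ, E) ∞ φ.symm φ.target ∧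
    ∀ x ∈ φ.source,
      Δ' (φ x) = (Δ x).map (mfderiv 𝓘(ℝ, E) 𝓘(ℝ, E') φ x).toLinearMap

/-- `π : (M', Δ') → (M, Δ)` is an integrable extension (covering): a surjective submersion which
maps `Δ'` isomorphically onto `Δ` pointwise, with `Δ'₂ ∩ Ker dπ = 0`. -/
structure IsIntegrableExtension (π : M' → M)
    (Δ' : ∀ x : M', Submodule ℝ (TangentSpace 𝓘(ℝ, E') x))
    (Δ : ∀ x : M, Submodule ℝ (TangentSpace 𝓘(ℝ, E) x)) : Prop where
  smooth : ContMDiff 𝓘(ℝ, E') 𝓘(ℝ, E) ∞ π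
  surjective : Function.Surjective π
  submersion : ∀ x, Function.Surjective (mfderiv 𝓘(ℝ, E') 𝓘(ℝ, E) π x)
  bijOn : ∀ x, Set.BijOn (mfderiv 𝓘(ℝ, E') 𝓘(ℝ, E) π x) (Δ' x) (Δ (π x))
  horizontal : ∀ x,
    weakFlag Δ' 2 x ⊓ (mfderiv 𝓘(ℝ, E') 𝓘(ℝ, E) π x).toLinearMap.ker = ⊥

/-- The tangents to the fibres of `π` have pure grading `-k` with respect to the weak derived flag
of `Δ'`: they lie in `Δ'_k` and meet `Δ'_{k-1}` trivially. -/
def HasPureGrading (π : M' → M) (Δ' : ∀ x : M', Submodule ℝ (TangentSpace 𝓘(ℝ, E') x))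
    (k : ℕ) : Prop :=
  ∀ x, (mfderiv 𝓘(ℝ, E') 𝓘(ℝ, E) π x).toLinearMap.ker ≤ weakFlag Δ' k x ∧
    weakFlag Δ' (k - 1) x ⊓ (mfderiv 𝓘(ℝ, E') 𝓘(ℝ, E) π x).toLinearMap.ker = ⊥

end Manifolds

/-! ### Flat distributions -/

section Flat

variable {L : Type*} [LieRing L] [LieAlgebra ℝ L]

/-- `L = ⊕_{i ≥ 1} g i` is a fundamental graded nilpotent Lie algebra; `g i` is the
component of degree `-i`, and fundamental means that the component of degree `-1` generates.
(In finite dimension such an `L` is automatically nilpotent.) -/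
structure IsFundamentalGNLA (g : ℕ → Submodule ℝ L) : Prop where
  finite : FiniteDimensional ℝ L
  zero : g 0 = ⊥
  internal : DirectSum.IsInternal g
  lie_mem : ∀ i j x y, x ∈ g i → y ∈ g j → ⁅x, y⁆ ∈ g (i + j)
  generates : LieSubalgebra.lieSpan ℝ L (g 1 : Set L) = ⊤

/-- The left-invariant Maurer-Cartan form of the simply connected Lie group of a finite-dimensional
nilpotent Lie algebra `L`, in exponential coordinates `exp : L → G` (a global diffeomorphism):
`θ_x = (1 - exp (-ad x)) / ad x = ∑ k, (-1)^k / (k+1)! (ad x)^k`. The sum is finite, since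
`(ad x)^k = 0` for `k ≥ dim L`. -/
def maurerCartan (x : L) : L →ₗ[ℝ] L :=
  ∑ k ∈ Finset.range (Module.finrank ℝ L),
    ((-1 : ℝ) ^ k / (Nat.factorial (k + 1) : ℝ)) • (LieAlgebra.ad ℝ L x) ^ k

variable {E : Type*} [NormedAddCommGroup E] [NormedSpace ℝ E]

/-- The standard model of a graded nilpotent Lie algebra: the left-invariant distribution defined
by the component of degree `-1` on the simply connected Lie group of `L`. The group is written
in exponential coordinates, and `e` chooses linear coordinates on `L`. -/
def standardDistribution (g : ℕ → Submodule ℝ L) (e : E ≃ₗ[ℝ] L) :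
    ∀ x : E, Submodule ℝ (TangentSpace 𝓘(ℝ, E) x) :=
  fun x => (g 1).comap (maurerCartan (e x) ∘ₗ e.toLinearMap)

/-- `Δ` is flat on `W`: near every point of `W` it is locally equivalent to the
standard model of one and the same fundamental graded nilpotent Lie algebra. -/
def IsFlatOn {M : Type*} [TopologicalSpace M] [ChartedSpace E M] [IsManifold 𝓘(ℝ, E) ∞ M]
    (Δ : ∀ x : M, Submodule ℝ (TangentSpace 𝓘(ℝ, E) x)) (W : Set M) : Prop :=
  ∃ (L : Type) (_ : LieRing L) (_ : LieAlgebra ℝ L) (g : ℕ → Submodule ℝ L) (e : E ≃ₗ[ℝ] L),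
    IsFundamentalGNLA g ∧ ∀ p ∈ W, LocallyEquivalentAt Δ p (standardDistribution g e)

end Flat

/-! ### Differential equations as rank 2 distributions -/

/-- The coordinate vector field `∂/∂w` in `ℝ^(N+2)` with coordinates `(x, u_1, …, u_N, w)`. -/
def lastVector (N : ℕ) : EuclideanSpace ℝ (Fin (N + 2)) :=
  EuclideanSpace.single (Fin.last (N + 1)) 1

/-- The total derivative `D_x = ∂/∂x + ∑ i, G_i ∂/∂u_i` of the system `u' = G(x, u, w)`. -/
def totalDerivative {N : ℕ} (G : EuclideanSpace ℝ (Fin (N + 2)) → Fin N → ℝ)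
    (p : EuclideanSpace ℝ (Fin (N + 2))) : EuclideanSpace ℝ (Fin (N + 2)) :=
  WithLp.toLp 2 (Fin.cons 1 (Fin.snoc (G p) 0) : Fin (N + 1 + 1) → ℝ)

/-- The rank 2 distribution `⟨D_x, ∂/∂w⟩` of the underdetermined system of ODEs
`u_i' = G_i(x, u_1, …, u_N, w)`, `1 ≤ i ≤ N`, in `ℝ^(N+2)` with coordinates
`(x, u_1, …, u_N, w)`. -/
def odeDistribution {N : ℕ} (G : EuclideanSpace ℝ (Fin (N + 2)) → Fin N → ℝ) :
    ∀ p : EuclideanSpace ℝ (Fin (N + 2)),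
      Submodule ℝ (TangentSpace 𝓘(ℝ, EuclideanSpace ℝ (Fin (N + 2))) p) :=
  fun p => Submodule.span ℝ
    ({totalDerivative G p, lastVector N} : Set (EuclideanSpace ℝ (Fin (N + 2))))

/-- The rank 2 distribution of the Monge equation
`y^(m) = F(x, y, …, y^(m-1), z, …, z^(n))` in `ℝ^(m+n+2)` with coordinates
`(x, y_0, …, y_(m-1), z_0, …, z_n)` (in this order): in `D_x` the coefficient of each jet
coordinate other than `z_n` is the next jet coordinate, except that the one of `y_(m-1)` is `F`. -/
def mongeDistribution (m n : ℕ) (F : EuclideanSpace ℝ (Fin (m + n + 2)) → ℝ) :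
    ∀ p : EuclideanSpace ℝ (Fin (m + n + 2)),
      Submodule ℝ (TangentSpace 𝓘(ℝ, EuclideanSpace ℝ (Fin (m + n + 2))) p) :=
  odeDistribution fun p i => if i.val + 1 = m then F p else p i.succ.succ

/-- The Hilbert-Cartan equation `y' = (z'')²` on `ℝ⁵` with coordinates `(x, y, z, z_1, z_2)`. -/
def hilbertCartan : ∀ p : EuclideanSpace ℝ (Fin 5),
    Submodule ℝ (TangentSpace 𝓘(ℝ, EuclideanSpace ℝ (Fin 5)) p) :=
  mongeDistribution 1 2 fun p => (p 4) ^ 2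

/-- The distributions on `ℝ^d` that are obtained from the Hilbert-Cartan equation by a finite
sequence of non-trivial integrable extensions with fibres of positive dimension and of pure grading
`-k`, `k > 3`, through flat rank 2 distributions. -/
inductive IsSuccessiveExtension : (d : ℕ) →
    (∀ x : EuclideanSpace ℝ (Fin d),
      Submodule ℝ (TangentSpace 𝓘(ℝ, EuclideanSpace ℝ (Fin d)) x)) → Prop
  | base : IsSuccessiveExtension 5 hilbertCartan
  | step {d d' : ℕ}
      {Δ : ∀ x : EuclideanSpace ℝ (Fin d),
        Submodule ℝ (TangentSpace 𝓘(ℝ, EuclideanSpace ℝ (Fin d)) x)}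
      {Δ' : ∀ x : EuclideanSpace ℝ (Fin d'),
        Submodule ℝ (TangentSpace 𝓘(ℝ, EuclideanSpace ℝ (Fin d')) x)}
      (π : EuclideanSpace ℝ (Fin d') → EuclideanSpace ℝ (Fin d)) (k : ℕ)
      (previous : IsSuccessiveExtension d Δ)
      (dim_lt : d < d')
      (rank_two : IsDistribution Δ' 2)
      (flat : IsFlatOn Δ' (Set.univ : Set (EuclideanSpace ℝ (Fin d'))))
      (extension : IsIntegrableExtension π Δ' Δ)
      (nontrivial : CompletelyNonholonomic Δ')
      (three_lt : 3 < k)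
      (pure : HasPureGrading (E := EuclideanSpace ℝ (Fin d)) π Δ' k) :
      IsSuccessiveExtension d' Δ'

/-- There is a distribution obtained from the Hilbert-Cartan equation by successive integrable
extensions to which `Δ` is locally equivalent near every point of `W`. -/
def ArisesFromHilbertCartanOn {E : Type*} [NormedAddCommGroup E] [NormedSpace ℝ E]
    {M : Type*} [TopologicalSpace M] [ChartedSpace E M] [IsManifold 𝓘(ℝ, E) ∞ M]
    (Δ : ∀ x : M, Submodule ℝ (TangentSpace 𝓘(ℝ, E) x)) (W : Set M) : Prop :=
  ∃ (d : ℕ) (Δ' : ∀ x : EuclideanSpace ℝ (Fin d),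
      Submodule ℝ (TangentSpace 𝓘(ℝ, EuclideanSpace ℝ (Fin d)) x)),
    IsSuccessiveExtension d Δ' ∧ ∀ p ∈ W, LocallyEquivalentAt Δ p Δ'

end Monge

end

set_option linter.unusedSectionVars false

/-! Flatness reduces the theorem to algebra: near every point the distribution is the left-invariant
one on the group of a single fundamental graded algebra. In the standard model the weak derived flag
is the left translate of the degree filtration (`mem_weakFlag_standardDistribution`), and the ranks
of the flag are invariant under diffeomorphisms (`Carries.finrank_weakFlag_eq`). The growth vector
therefore says that `g 1`, `g 2`, `g 3` have dimensions 2, 1, 2.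

If no further component occurs, the algebra is the free 3-step nilpotent algebra on two generators,
and an explicit polynomial diffeomorphism of ℝ⁵ takes its model to the Hilbert–Cartan equation
(`carries_hilbertCartanChart`). Otherwise the component of lowest degree `-μ`, `μ > 3`, is an ideal.
The quotient is again fundamental, is shorter, and has the same first three dimensions. The
projection of groups is an integrable extension whose fibres are tangent to the left translates of
`g μ`, hence of pure grading `-μ`. Induction on the depth gives the tower
(`exists_isSuccessiveExtension`).

The group is handled only through its Maurer–Cartan form in exponential coordinates: it is
invertible, natural under homomorphisms, and satisfies the Maurer–Cartan equation, which follows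
from uniqueness for a linear ODE along rays. For Monge equations it remains to bound the growth
vector below (`growth_mongeDistribution`). Lower bounds suffice, because two generators give at most
1 and 2 dimensions in degrees -2 and -3. -/

namespace Monge

/-! ### The Maurer–Cartan form of a nilpotent bracket in exponential coordinates. -/

section BilinearBracket

variable {E : Type*} [NormedAddCommGroup E] [NormedSpace ℝ E]

/-- The coefficients of the power series `(1 - exp (-z)) / z`. -/
noncomputable def mcCoeff (k : ℕ) : ℝ := (-1 : ℝ) ^ k / (Nat.factorial (k + 1) : ℝ)

theorem mcCoeff_zero : mcCoeff 0 = 1 := by simp [mcCoeff]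

/-- This is the coefficient form of `(zφ)' = 1 - zφ` for `φ = (1 - exp (-z)) / z`. The ODE argument
uses nothing else about the coefficients except `mcCoeff_zero`. -/
theorem mcCoeff_succ (k : ℕ) : mcCoeff (k + 1) * ((k : ℝ) + 2) = -mcCoeff k := by
  unfold mcCoeff
  rw [Nat.factorial_succ (k + 1)]
  have h1 : ((k + 1).factorial : ℝ) ≠ 0 := by positivity
  have h2 : ((k : ℝ) + 2) ≠ 0 := by positivity
  push_cast
  field_simp
  ring

/-- The Maurer-Cartan form of a nilpotent bracket `B` of length at most `N`. -/
noncomputable def mcForm (B : E →L[ℝ] E →L[ℝ] E) (N : ℕ) (x : E) : E →L[ℝ] E :=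
  ∑ k ∈ Finset.range N, mcCoeff k • (B x) ^ k

/-- The derivative of `x ↦ (B x) ^ k` in the direction `v`. -/
noncomputable def powDeriv (B : E →L[ℝ] E →L[ℝ] E) (x v : E) : ℕ → (E →L[ℝ] E)
  | 0 => 0
  | k + 1 => B v * (B x) ^ k + B x * powDeriv B x v k

variable {B : E →L[ℝ] E →L[ℝ] E} {N : ℕ}

theorem contDiff_mcForm : ContDiff ℝ ∞ (mcForm B N) := by
  unfold mcForm
  refine ContDiff.sum fun k _ => ContDiff.const_smul _ ?_
  exact B.contDiff.pow k

theorem hasDerivAt_pow_line (x v : E) (k : ℕ) (s : ℝ) :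
    HasDerivAt (fun s : ℝ => (B (x + s • v)) ^ k) (powDeriv B (x + s • v) v k) s := by
  have hB : HasDerivAt (fun s : ℝ => B (x + s • v)) (B v) s := by
    have h : HasDerivAt (fun s : ℝ => x + s • v) v s := by
      simpa using ((hasDerivAt_id s).smul_const v).const_add x
    exact B.hasFDerivAt.comp_hasDerivAt s h
  induction k with
  | zero => simpa [powDeriv] using hasDerivAt_const s (1 : E →L[ℝ] E)
  | succ k ih =>
    simp only [pow_succ', powDeriv]
    exact hB.fun_mul ih

/-- The identity `(B x) ^ N = 0` holds for all `x`, so it may be differentiated. -/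
theorem powDeriv_eq_zero (hN : ∀ x, (B x) ^ N = 0) (x v : E) : powDeriv B x v N = 0 := by
  have h := hasDerivAt_pow_line (B := B) x v N 0
  simp only [hN, zero_smul, add_zero] at h
  exact h.unique (hasDerivAt_const _ _)

theorem fderiv_mcForm (x v : E) :
    fderiv ℝ (mcForm B N) x v = ∑ k ∈ Finset.range N, mcCoeff k • powDeriv B x v k := by
  have h1 : HasDerivAt (fun s : ℝ => mcForm B N (x + s • v))
      (∑ k ∈ Finset.range N, mcCoeff k • powDeriv B x v k) 0 := by
    unfold mcForm
    refine HasDerivAt.fun_sum fun k _ => ?_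
    have h := hasDerivAt_pow_line (B := B) x v k 0
    rw [zero_smul, add_zero] at h
    exact h.fun_const_smul _
  have h2 : HasDerivAt (fun s : ℝ => mcForm B N (x + s • v)) (fderiv ℝ (mcForm B N) x v) 0 := by
    have h : HasDerivAt (fun s : ℝ => x + s • v) v 0 := by
      simpa using ((hasDerivAt_id (0 : ℝ)).smul_const v).const_add x
    have hd : HasFDerivAt (mcForm B N) (fderiv ℝ (mcForm B N) x) (x + (0 : ℝ) • v) := by
      simpa using (contDiff_mcForm.differentiable (by simp) x).hasFDerivAt
    exact hd.comp_hasDerivAt 0 h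
  exact h2.unique h1

/-- Auxiliary polynomial `∑ k < N, c_k t ^ (k + 1) a_k`. -/
noncomputable def mcPoly (N : ℕ) (a : ℕ → E) (t : ℝ) : E :=
  ∑ k ∈ Finset.range N, (mcCoeff k * t ^ (k + 1)) • a k

/-- Differentiation produces the factors `k + 1`, which by `mcCoeff_succ` turn each coefficient into
minus the preceding one. The sum becomes `a 0` minus the same sum over the shifted sequence, and `a
N = 0` removes the top term. With `a k = (B x) ^ k v` the polynomial is `t θ_{tx}(v)`, where `θ` is
`mcForm B N`. -/
theorem hasDerivAt_mcPoly (a b : ℕ → E) (x : E) (h : ∀ k, a (k + 1) = b k + B x (a k))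
    (hN : a N = 0) (t : ℝ) :
    HasDerivAt (mcPoly N a) (a 0 - mcPoly N b t - B x (mcPoly N a t)) t := by
  have hd : HasDerivAt (mcPoly N a)
      (∑ k ∈ Finset.range N, (mcCoeff k * (((k + 1 : ℕ) : ℝ) * t ^ k)) • a k) t := by
    unfold mcPoly
    refine HasDerivAt.fun_sum fun k _ => HasDerivAt.smul_const ?_ _
    simpa using (hasDerivAt_pow (k + 1) t).const_mul (mcCoeff k)
  convert hd using 1
  have h1 : mcPoly N b t + B x (mcPoly N a t) =
      ∑ k ∈ Finset.range N, (mcCoeff k * t ^ (k + 1)) • a (k + 1) := by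
    simp only [mcPoly, map_sum, map_smul, h, smul_add, Finset.sum_add_distrib]
  rw [sub_sub, h1]
  cases N with
  | zero => simp [hN]
  | succ n =>
    rw [Finset.sum_range_succ (fun k => (mcCoeff k * t ^ (k + 1)) • a (k + 1)),
      Finset.sum_range_succ', hN, smul_zero, add_zero,
      sub_eq_iff_eq_add, add_right_comm, ← Finset.sum_add_distrib]
    have : ∀ k ∈ Finset.range n, (mcCoeff (k + 1) * (((k + 1 + 1 : ℕ) : ℝ) * t ^ (k + 1))) • a (k + 1)
        + (mcCoeff k * t ^ (k + 1)) • a (k + 1) = 0 := fun k _ => by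
      have := mcCoeff_succ k
      rw [← add_smul, show mcCoeff (k + 1) * (((k + 1 + 1 : ℕ) : ℝ) * t ^ (k + 1)) +
        mcCoeff k * t ^ (k + 1) = (mcCoeff (k + 1) * ((k : ℝ) + 2) + mcCoeff k) * t ^ (k + 1) by
        push_cast; ring, this]
      simp
    rw [Finset.sum_eq_zero this]
    simp [mcCoeff_zero]

theorem mcForm_apply_eq (x v : E) :
    mcForm B N x v = mcPoly N (fun k => ((B x) ^ k) v) 1 := by
  simp [mcForm, mcPoly]

theorem fderiv_mcForm_apply_eq (x v w : E) :
    fderiv ℝ (mcForm B N) x v w = mcPoly N (fun k => powDeriv B x v k w) 1 := by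
  simp [fderiv_mcForm, mcPoly]

/-- The Maurer-Cartan equation. -/
theorem maurerCartan_equation (skew : ∀ x y, B x y = -B y x)
    (jacobi : ∀ x y z, B x (B y z) = B (B x y) z + B y (B x z))
    (hN : ∀ x, (B x) ^ N = 0) (x v w : E) :
    fderiv ℝ (mcForm B N) x v w - fderiv ℝ (mcForm B N) x w v
      + B (mcForm B N x v) (mcForm B N x w) = 0 := by
  have hpow : ∀ u : E, ∀ t, HasDerivAt (mcPoly N fun k => ((B x) ^ k) u)
      (u - B x (mcPoly N (fun k => ((B x) ^ k) u) t)) t := fun u t => by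
    have := hasDerivAt_mcPoly (B := B) (N := N) (fun k => ((B x) ^ k) u) (fun _ => 0) x
      (fun k => by simp [pow_succ']) (by simp [hN]) t
    simpa [mcPoly] using this
  have hder : ∀ u z : E, ∀ t, HasDerivAt (mcPoly N fun k => powDeriv B x u k z)
      (- B u (mcPoly N (fun k => ((B x) ^ k) z) t)
        - B x (mcPoly N (fun k => powDeriv B x u k z) t)) t := fun u z t => by
    have := hasDerivAt_mcPoly (B := B) (N := N) (fun k => powDeriv B x u k z)
      (fun k => B u (((B x) ^ k) z)) x
      (fun k => by simp [powDeriv]) (by simp [powDeriv_eq_zero hN]) t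
    convert this using 1
    simp [mcPoly, powDeriv, map_sum]
  -- `f t` is `t ^ 2` times the left-hand side of the claim taken at `t • x`. The Jacobi identity
  -- gives `f' = -B x f`, and `f 0 = 0`, so `f` vanishes; `t = 1` is the claim.
  set f : ℝ → E := fun t => mcPoly N (fun k => powDeriv B x v k w) t
    - mcPoly N (fun k => powDeriv B x w k v) t
    + B (mcPoly N (fun k => ((B x) ^ k) v) t) (mcPoly N (fun k => ((B x) ^ k) w) t) with hf
  have hf' : ∀ t, HasDerivAt f (-(B x (f t))) t := fun t => by
    have h1 := (hder v w t).fun_sub (hder w v t)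
    have h2 : HasDerivAt (fun t => B (mcPoly N (fun k => ((B x) ^ k) v) t)
        (mcPoly N (fun k => ((B x) ^ k) w) t)) _ t :=
      (B.hasFDerivAt.comp_hasDerivAt t (hpow v t)).clm_apply (hpow w t)
    convert h1.fun_add h2 using 1
    simp only [hf, map_add, map_sub, sub_apply, Function.comp]
    rw [jacobi x (mcPoly N (fun k => ((B x) ^ k) v) t), skew (mcPoly N (fun k => ((B x) ^ k) v) t) w]
    abel
  have hz : f = fun _ => 0 := by
    refine ODE_solution_unique_univ (v := fun _ y => -(B x y)) (s := fun _ => Set.univ) (t₀ := 0)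
      (K := ‖B x‖₊) (fun t => ?_) (fun t => ⟨hf' t, trivial⟩)
      (fun t => ⟨by simpa using hasDerivAt_const t (0 : E), trivial⟩) ?_
    · exact (B x).lipschitz.neg.lipschitzOnWith
    · simp [hf, mcPoly]
  have := congrFun hz 1
  simp only [hf] at this
  rw [fderiv_mcForm_apply_eq, fderiv_mcForm_apply_eq, mcForm_apply_eq, mcForm_apply_eq]
  exact this

/-- The constant coefficient is 1 and all other terms are multiples of the nilpotent `B x`. -/
theorem isUnit_mcForm (hN : ∀ x, (B x) ^ N = 0) (x : E) : IsUnit (mcForm B N x) := by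
  cases N with
  | zero =>
    have : (1 : E →L[ℝ] E) = 0 := by simpa using hN x
    have hs := subsingleton_of_zero_eq_one this.symm
    exact isUnit_of_subsingleton _
  | succ n =>
    have h : mcForm B (n + 1) x =
        (∑ k ∈ Finset.range n, mcCoeff (k + 1) • (B x) ^ k) * B x + 1 := by
      simp [mcForm, Finset.sum_range_succ', mcCoeff_zero, Finset.sum_mul, pow_succ]
    rw [h]
    refine IsNilpotent.isUnit_add_one ?_
    refine Commute.isNilpotent_mul_left (Commute.sum_left _ _ _ fun k _ => ?_) ⟨n + 1, hN x⟩
    exact ((Commute.refl (B x)).pow_left k).smul_left _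

/-- The left-invariant vector field with value `a` of the Maurer-Cartan form. -/
noncomputable def leftInvariant (B : E →L[ℝ] E →L[ℝ] E) (N : ℕ) (a : E) (x : E) : E :=
  Ring.inverse (mcForm B N x) a

theorem mcForm_leftInvariant (hN : ∀ x, (B x) ^ N = 0) (a x : E) :
    mcForm B N x (leftInvariant B N a x) = a := by
  have := Ring.mul_inverse_cancel _ (isUnit_mcForm hN x)
  exact congrArg (fun T : E →L[ℝ] E => T a) this

theorem leftInvariant_mcForm (hN : ∀ x, (B x) ^ N = 0) (v x : E) :
    leftInvariant B N (mcForm B N x v) x = v := by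
  have := Ring.inverse_mul_cancel _ (isUnit_mcForm hN x)
  exact congrArg (fun T : E →L[ℝ] E => T v) this

theorem mcForm_injective (hN : ∀ x, (B x) ^ N = 0) (x : E) :
    Function.Injective (mcForm B N x) :=
  Function.LeftInverse.injective fun v => leftInvariant_mcForm hN v x

theorem contDiff_leftInvariant [CompleteSpace E] (hN : ∀ x, (B x) ^ N = 0) (a : E) :
    ContDiff ℝ ∞ (leftInvariant B N a) := by
  rw [contDiff_iff_contDiffAt]
  intro x
  obtain ⟨u, hu⟩ := isUnit_mcForm hN x
  have h0 : ContDiffAt ℝ ∞ (Ring.inverse : (E →L[ℝ] E) → E →L[ℝ] E) (mcForm B N x) := by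
    rw [← hu]
    exact contDiffAt_ringInverse ℝ u
  have h : ContDiffAt ℝ ∞ (fun y => Ring.inverse (mcForm B N y)) x :=
    h0.comp x contDiff_mcForm.contDiffAt
  exact h.clm_apply contDiffAt_const

/-- By the product rule, the two sides differ by the antisymmetrised derivative of the form plus the
bracket term, which is zero by the Maurer–Cartan equation. -/
theorem mcForm_lieBracket (skew : ∀ x y, B x y = -B y x)
    (jacobi : ∀ x y z, B x (B y z) = B (B x y) z + B y (B x z))
    (hN : ∀ x, (B x) ^ N = 0) {X Y : E → E} {x : E}
    (hX : DifferentiableAt ℝ X x) (hY : DifferentiableAt ℝ Y x) :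
    mcForm B N x (VectorField.lieBracket ℝ X Y x) =
      B (mcForm B N x (X x)) (mcForm B N x (Y x))
      + fderiv ℝ (fun y => mcForm B N y (Y y)) x (X x)
      - fderiv ℝ (fun y => mcForm B N y (X y)) x (Y x) := by
  have hd : DifferentiableAt ℝ (mcForm B N) x := contDiff_mcForm.differentiable (by simp) x
  rw [fderiv_clm_apply hd hY, fderiv_clm_apply hd hX, VectorField.lieBracket]
  have := maurerCartan_equation skew jacobi hN x (X x) (Y x)
  simp only [map_sub, add_apply, ContinuousLinearMap.comp_apply,
    ContinuousLinearMap.flip_apply]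
  rw [← sub_eq_zero, ← neg_eq_zero, ← this]
  abel

end BilinearBracket
-- Fundamental graded algebras: degree filtration, generation and nilpotency.
section Graded

variable {L : Type*} [LieRing L] [LieAlgebra ℝ L] {g : ℕ → Submodule ℝ L}

/-- The sum of the components of degree at least `-k`. -/
def gradedFlag (g : ℕ → Submodule ℝ L) (k : ℕ) : Submodule ℝ L := ⨆ i ∈ Set.Iic k, g i

theorem gradedFlag_succ (g : ℕ → Submodule ℝ L) (k : ℕ) :
    gradedFlag g (k + 1) = gradedFlag g k ⊔ g (k + 1) := by
  have : Set.Iic (k + 1) = insert (k + 1) (Set.Iic k) := by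
    ext i; simp only [Set.mem_Iic, Set.mem_insert_iff]; omega
  rw [gradedFlag, this, iSup_insert, sup_comm]
  rfl

theorem gradedFlag_zero (g : ℕ → Submodule ℝ L) : gradedFlag g 0 = g 0 := by
  have : Set.Iic 0 = ({0} : Set ℕ) := by ext i; simp
  rw [gradedFlag, this, iSup_singleton]

theorem le_gradedFlag {i k : ℕ} (h : i ≤ k) : g i ≤ gradedFlag g k :=
  le_biSup g (Set.mem_Iic.2 h)

theorem gradedFlag_mono {i k : ℕ} (h : i ≤ k) : gradedFlag g i ≤ gradedFlag g k :=
  iSup₂_le fun _ hj => le_gradedFlag (le_trans hj h)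

namespace IsFundamentalGNLA

variable (hg : IsFundamentalGNLA g)
include hg

theorem indep : iSupIndep g := hg.internal.submodule_iSupIndep

theorem iSup_eq_top : ⨆ i, g i = ⊤ := hg.internal.submodule_iSup_eq_top

theorem gradedFlag_one : gradedFlag g 1 = g 1 := by
  rw [gradedFlag_succ, gradedFlag_zero, hg.zero, bot_sup_eq]

theorem disjoint_gradedFlag {i k : ℕ} (h : k < i) : Disjoint (g i) (gradedFlag g k) :=
  hg.indep.disjoint_biSup (by simpa using h)

theorem lie_mem_gradedFlag {k : ℕ} {x y : L} (hx : x ∈ g 1) (hy : y ∈ gradedFlag g k) :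
    ⁅x, y⁆ ∈ gradedFlag g (k + 1) := by
  have : gradedFlag g k ≤ (gradedFlag g (k + 1)).comap (LieAlgebra.ad ℝ L x : L →ₗ[ℝ] L) := by
    refine iSup₂_le fun i hi y hy => ?_
    have h := hg.lie_mem 1 i x y hx hy
    exact le_gradedFlag (show 1 + i ≤ k + 1 by have : i ≤ k := hi; omega) h
  exact this hy

theorem finrank_gradedFlag_succ (k : ℕ) :
    Module.finrank ℝ (gradedFlag g (k + 1)) =
      Module.finrank ℝ (gradedFlag g k) + Module.finrank ℝ (g (k + 1)) := by
  have := hg.finite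
  have h := Submodule.finrank_sup_add_finrank_inf_eq (gradedFlag g k) (g (k + 1))
  rw [(hg.disjoint_gradedFlag k.lt_succ_self).symm.eq_bot, finrank_bot, add_zero] at h
  rw [gradedFlag_succ, h]

theorem exists_eq_bot : ∃ μ, ∀ i, μ < i → g i = ⊥ := by
  have := hg.finite
  have hfin : {i | g i ≠ ⊥}.Finite := WellFoundedGT.finite_ne_bot_of_iSupIndep hg.indep
  obtain ⟨μ, hμ⟩ := hfin.bddAbove
  refine ⟨μ, fun i hi => ?_⟩
  by_contra h
  exact absurd (hμ h) (by omega)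

theorem gradedFlag_eq_top {μ : ℕ} (hμ : ∀ i, μ < i → g i = ⊥) : gradedFlag g μ = ⊤ := by
  rw [eq_top_iff, ← hg.iSup_eq_top]
  refine iSup_le fun i => ?_
  by_cases h : i ≤ μ
  · exact le_gradedFlag h
  · rw [hμ i (by omega)]; exact bot_le

/-- The component of degree `-(k + 1)` is spanned by brackets, since `g 1` generates. -/
theorem eq_span_lie (k : ℕ) :
    g (k + 2) = Submodule.span ℝ {v | ∃ x ∈ g 1, ∃ y ∈ g (k + 1), v = ⁅x, y⁆} := by
  -- Candidate components `h i ≤ g i`: the generators in degree -1, and below that only brackets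
  -- with generators. It is enough that they already sum to `L`.
  set h : ℕ → Submodule ℝ L := fun i => i.casesOn ⊥ fun j => j.casesOn (g 1) fun k =>
    Submodule.span ℝ {v | ∃ x ∈ g 1, ∃ y ∈ g (k + 1), v = ⁅x, y⁆} with hh
  have hle : ∀ i, h i ≤ g i := by
    rintro (_ | _ | k)
    · exact bot_le
    · exact le_rfl
    · refine Submodule.span_le.2 ?_
      rintro v ⟨x, hx, y, hy, rfl⟩
      have := hg.lie_mem 1 (k + 1) x y hx hy
      rwa [show 1 + (k + 1) = k + 2 by ring] at this
  have hlie : ∀ x ∈ g 1, ∀ y : L, ⁅x, y⁆ ∈ ⨆ i, h i := by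
    intro x hx y
    have : (⊤ : Submodule ℝ L) ≤ (⨆ i, h i).comap (LieAlgebra.ad ℝ L x : L →ₗ[ℝ] L) := by
      rw [← hg.iSup_eq_top]
      refine iSup_le fun i y hy => ?_
      cases i with
      | zero =>
        rw [hg.zero, Submodule.mem_bot] at hy
        simp [hy]
      | succ j =>
        exact Submodule.mem_iSup_of_mem (j + 2) (Submodule.subset_span ⟨x, hx, y, hy, rfl⟩)
    exact this (Submodule.mem_top (x := y))
  have htop : ⨆ i, h i = ⊤ := by
    -- The sum of the `h i` is a subalgebra: the elements whose bracket with all of `L` lands in it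
    -- include `g 1` and, by Jacobi, are closed under brackets.
    let S : LieSubalgebra ℝ L :=
      { (⨆ i, h i) with
        lie_mem' := by
          intro x y hx' hy'
          clear hx' hy'
          have hx : x ∈ LieSubalgebra.lieSpan ℝ L (g 1 : Set L) := by rw [hg.generates]; trivial
          have : ∀ z, ⁅x, z⁆ ∈ ⨆ i, h i := by
            induction hx using LieSubalgebra.lieSpan_induction with
            | mem x hx => exact hlie x hx
            | zero => intro z; simp
            | add a b _ _ ha hb => intro z; rw [add_lie]; exact add_mem (ha z) (hb z)
            | smul c a _ ha => intro z; rw [smul_lie]; exact Submodule.smul_mem _ c (ha z)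
            | lie a b _ _ ha hb =>
              intro z
              rw [lie_lie]
              exact sub_mem (ha _) (hb _)
          exact this y }
    have hS : LieSubalgebra.lieSpan ℝ L (g 1 : Set L) ≤ S :=
      LieSubalgebra.lieSpan_le.2 fun x hx => (Submodule.mem_iSup_of_mem 1 hx : x ∈ ⨆ i, h i)
    rw [hg.generates] at hS
    exact eq_top_iff.2 fun x _ => hS (LieSubalgebra.mem_top x)
  refine le_antisymm (fun x hx => ?_) (hle (k + 2))
  -- Now compare degrees: an element of `g (k + 2)` has no part in the other components, so it lies
  -- in `h (k + 2)`.
  have hsplit : (⊤ : Submodule ℝ L) ≤ h (k + 2) ⊔ ⨆ j, ⨆ (_ : j ≠ k + 2), g j := by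
    rw [← htop]
    refine iSup_le fun i => ?_
    by_cases hi : i = k + 2
    · subst hi; exact le_sup_left
    · exact le_sup_of_le_right ((hle i).trans (le_iSup₂_of_le i hi le_rfl))
  obtain ⟨a, ha, b, hb, rfl⟩ := Submodule.mem_sup.1 (hsplit (Submodule.mem_top (x := x)))
  have hb' : b ∈ g (k + 2) := by
    have := sub_mem hx (hle _ ha)
    rwa [add_sub_cancel_left] at this
  have : b = 0 := Submodule.disjoint_def.1 (hg.indep (k + 2)) b hb' hb
  rw [this, add_zero]
  exact ha

/-- Since `g 0 = ⊥`, every homogeneous part of `x` that matters has index at least 1 and raises the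
index of `y`. -/
theorem lie_mem_biSup_Ici (x : L) {n : ℕ} {y : L} (hy : y ∈ ⨆ i ∈ Set.Ici n, g i) :
    ⁅x, y⁆ ∈ ⨆ i ∈ Set.Ici (n + 1), g i := by
  have hx : x ∈ ⨆ i, g i := by rw [hg.iSup_eq_top]; trivial
  induction hx using Submodule.iSup_induction' with
  | mem j x hx =>
    have : (⨆ i ∈ Set.Ici n, g i) ≤
        (⨆ i ∈ Set.Ici (n + 1), g i).comap (LieAlgebra.ad ℝ L x : L →ₗ[ℝ] L) := by
      refine iSup₂_le fun i hi y hy => ?_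
      by_cases hj : j = 0
      · rw [hj, hg.zero, Submodule.mem_bot] at hx
        simp [hx]
      · have hi' : n ≤ i := hi
        exact (le_biSup g (i := j + i) (Set.mem_Ici.2 (by omega))) (hg.lie_mem j i x y hx hy)
    exact this hy
  | zero => simp
  | add a b _ _ ha hb => rw [add_lie]; exact add_mem ha hb

/-- This is what makes the truncation of `maurerCartan` at `dim L` harmless. The grading gives
nilpotency with some exponent, and the kernels of the powers of an endomorphism are stable from the
dimension on. -/
theorem ad_pow_finrank (x : L) : (LieAlgebra.ad ℝ L x) ^ (Module.finrank ℝ L) = 0 := by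
  have := hg.finite
  obtain ⟨μ, hμ⟩ := hg.exists_eq_bot
  have hmem : ∀ n, ∀ y : L, ((LieAlgebra.ad ℝ L x) ^ n) y ∈ ⨆ i ∈ Set.Ici n, g i := by
    intro n y
    induction n with
    | zero =>
      have : (⨆ i ∈ Set.Ici 0, g i) = ⊤ := by simpa using hg.iSup_eq_top
      rw [this]; trivial
    | succ n ih =>
      rw [pow_succ']
      exact hg.lie_mem_biSup_Ici x ih
  have hbot : (⨆ i ∈ Set.Ici (μ + 1), g i) = ⊥ := by
    rw [eq_bot_iff]
    refine iSup₂_le fun i hi => ?_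
    rw [hμ i hi]
  ext y
  have hy : y ∈ LinearMap.ker ((LieAlgebra.ad ℝ L x : Module.End ℝ L) ^ (μ + 1)) := by
    have := hmem (μ + 1) y
    rw [hbot, Submodule.mem_bot] at this
    exact this
  exact LinearMap.mem_ker.1 (Module.End.ker_pow_le_ker_pow_finrank _ _ hy)

end IsFundamentalGNLA
end Graded
-- Vector fields on a vector space.
section VectorSpace

variable {E : Type*} [NormedAddCommGroup E] [NormedSpace ℝ E]

theorem mlieBracket_eq_lieBracket (X Y : E → E) (x : E) :
    VectorField.mlieBracket 𝓘(ℝ, E) X Y x = VectorField.lieBracket ℝ X Y x :=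
  (congrFun VectorField.mlieBracketWithin_univ x).symm.trans
    ((congrFun VectorField.mlieBracketWithin_eq_lieBracketWithin x).trans
      (congrFun VectorField.lieBracketWithin_univ x))

theorem SmoothOn.contDiffAt {X : E → E} {U : Set E} (hU : IsOpen U) {x : E} (hx : x ∈ U)
    (hX : SmoothOn (E := E) (M := E) X U) : ContDiffAt ℝ ∞ X x :=
  (contMDiffOn_vectorSpace_iff_contDiffOn.1 hX).contDiffAt (hU.mem_nhds hx)

/-- A projection with kernel `S` annihilates `f` near `x`, hence also its derivative. -/
theorem fderiv_mem_of_eventually_mem {F : Type*} [NormedAddCommGroup F] [NormedSpace ℝ F]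
    [FiniteDimensional ℝ F] {f : E → F} {x : E} (hf : DifferentiableAt ℝ f x) {S : Submodule ℝ F}
    (h : ∀ᶠ y in 𝓝 x, f y ∈ S) (v : E) : fderiv ℝ f x v ∈ S := by
  obtain ⟨p, hp⟩ := S.exists_isCompl
  let P : F →ₗ[ℝ] p := Submodule.projectionOnto p S hp.symm
  have hker : ∀ w, P w = 0 ↔ w ∈ S := fun w => Submodule.projectionOnto_apply_eq_zero_iff hp.symm
  have h1 : HasFDerivAt (fun y => P.toContinuousLinearMap (f y))
      (P.toContinuousLinearMap.comp (fderiv ℝ f x)) x :=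
    P.toContinuousLinearMap.hasFDerivAt.comp x hf.hasFDerivAt
  have h2 : HasFDerivAt (fun y => P.toContinuousLinearMap (f y)) (0 : E →L[ℝ] p) x := by
    refine (hasFDerivAt_const (0 : p) x).congr_of_eventuallyEq ?_
    filter_upwards [h] with y hy
    exact (hker _).2 hy
  have := congrArg (fun T : E →L[ℝ] p => T v) (h1.unique h2)
  exact (hker _).1 this

end VectorSpace

/-! ### The standard model and its weak derived flag. -/

section StandardModel

variable {L : Type*} [LieRing L] [LieAlgebra ℝ L] {g : ℕ → Submodule ℝ L}
  {E : Type*} [NormedAddCommGroup E] [NormedSpace ℝ E] [FiniteDimensional ℝ E]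

/-- The Lie bracket of `L` in the linear coordinates `e`. -/
noncomputable def coordBracket (e : E ≃ₗ[ℝ] L) : E →L[ℝ] E →L[ℝ] E :=
  LinearMap.toContinuousBilinearMap
    (LinearMap.mk₂ ℝ (fun x y => e.symm ⁅e x, e y⁆)
      (fun x y z => by simp) (fun c x y => by simp) (fun x y z => by simp) (fun c x y => by simp))

theorem coordBracket_apply (e : E ≃ₗ[ℝ] L) (x y : E) :
    coordBracket e x y = e.symm ⁅e x, e y⁆ := by
  simp [coordBracket]

theorem coordBracket_skew (e : E ≃ₗ[ℝ] L) (x y : E) :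
    coordBracket e x y = -coordBracket e y x := by
  rw [coordBracket_apply, coordBracket_apply, ← lie_skew, map_neg]

theorem coordBracket_jacobi (e : E ≃ₗ[ℝ] L) (x y z : E) :
    coordBracket e x (coordBracket e y z) =
      coordBracket e (coordBracket e x y) z + coordBracket e y (coordBracket e x z) := by
  simp only [coordBracket_apply, LinearEquiv.apply_symm_apply]
  rw [leibniz_lie, map_add]

theorem coordBracket_pow_apply (e : E ≃ₗ[ℝ] L) (x v : E) (k : ℕ) :
    e (((coordBracket e x) ^ k) v) = ((LieAlgebra.ad ℝ L (e x)) ^ k) (e v) := by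
  induction k with
  | zero => simp
  | succ k ih =>
    simp only [pow_succ', mul_apply_eq_comp, Module.End.mul_apply, coordBracket_apply,
      LinearEquiv.apply_symm_apply, ih, LieAlgebra.ad_apply]

/-- The Maurer-Cartan form in the linear coordinates `e`. -/
noncomputable def coordForm (e : E ≃ₗ[ℝ] L) : E → E →L[ℝ] E :=
  mcForm (coordBracket e) (Module.finrank ℝ L)

theorem coordForm_apply (e : E ≃ₗ[ℝ] L) (x v : E) :
    e (coordForm e x v) = maurerCartan (e x) (e v) := by
  simp only [coordForm, mcForm, maurerCartan, mcCoeff, sum_apply, smul_apply,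
    LinearMap.coe_sum, Finset.sum_apply, LinearMap.smul_apply, map_sum, map_smul, coordBracket_pow_apply]

/-- The left-invariant vector fields in the linear coordinates `e`. -/
noncomputable def coordField (e : E ≃ₗ[ℝ] L) (a : L) : E → E :=
  leftInvariant (coordBracket e) (Module.finrank ℝ L) (e.symm a)

theorem mem_standardDistribution {e : E ≃ₗ[ℝ] L} {x : E} {v : TangentSpace 𝓘(ℝ, E) x} :
    v ∈ standardDistribution g e x ↔ e (coordForm e x v) ∈ g 1 :=
  iff_of_eq (congrArg (· ∈ g 1) (coordForm_apply e x v).symm)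

theorem IsFundamentalGNLA.coordBracket_pow (hg : IsFundamentalGNLA g) (e : E ≃ₗ[ℝ] L) (x : E) :
    (coordBracket e x) ^ (Module.finrank ℝ L) = 0 := by
  ext v
  apply e.injective
  rw [coordBracket_pow_apply, hg.ad_pow_finrank]
  simp

variable (hg : IsFundamentalGNLA g) (e : E ≃ₗ[ℝ] L)

section
include hg

theorem coordForm_coordField (a : L) (x : E) : e (coordForm e x (coordField e a x)) = a := by
  unfold coordForm coordField
  rw [mcForm_leftInvariant (hg.coordBracket_pow e), LinearEquiv.apply_symm_apply]

theorem coordField_coordForm (x v : E) : coordField e (e (coordForm e x v)) x = v := by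
  unfold coordForm coordField
  rw [LinearEquiv.symm_apply_apply, leftInvariant_mcForm (hg.coordBracket_pow e)]

theorem coordForm_injective (x : E) : Function.Injective (coordForm e x) :=
  mcForm_injective (hg.coordBracket_pow e) x

theorem contDiff_coordField (a : L) : ContDiff ℝ ∞ (coordField e a) :=
  have := FiniteDimensional.complete ℝ E
  contDiff_leftInvariant (hg.coordBracket_pow e) _

theorem coordForm_lieBracket {X Y : E → E} {x : E}
    (hX : DifferentiableAt ℝ X x) (hY : DifferentiableAt ℝ Y x) :
    coordForm e x (VectorField.lieBracket ℝ X Y x) =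
      coordBracket e (coordForm e x (X x)) (coordForm e x (Y x))
      + fderiv ℝ (fun y => coordForm e y (Y y)) x (X x)
      - fderiv ℝ (fun y => coordForm e y (X y)) x (Y x) :=
  mcForm_lieBracket (coordBracket_skew e) (coordBracket_jacobi e) (hg.coordBracket_pow e) hX hY

theorem coordForm_lieBracket_coordField (a b : L) (x : E) :
    e (coordForm e x (VectorField.lieBracket ℝ (coordField e a) (coordField e b) x)) = ⁅a, b⁆ := by
  have hd : ∀ a, DifferentiableAt ℝ (coordField e a) x := fun a =>
    (contDiff_coordField hg e a).differentiable (by simp) x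
  have hc : ∀ a y, coordForm e y (coordField e a y) = e.symm a := fun a y => by
    rw [← coordForm_coordField hg e a y, LinearEquiv.symm_apply_apply, coordForm_coordField hg]
  rw [coordForm_lieBracket hg e (hd a) (hd b)]
  simp [hc, coordBracket_apply]

end

theorem contDiff_coordForm : ContDiff ℝ ∞ (coordForm e) := contDiff_mcForm

include hg in
-- The form trivialises the tangent bundle and takes the flag to the constant filtration `gradedFlag
-- g`. One inclusion comes from the structure equation, the other from left-invariant fields
-- together with generation by `g 1`.
theorem mem_weakFlag_standardDistribution (k : ℕ) :
    ∀ (x : E) (v : TangentSpace 𝓘(ℝ, E) x),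
      v ∈ weakFlag (standardDistribution g e) k x ↔ e (coordForm e x v) ∈ gradedFlag g k := by
  have field_mem : ∀ (a : L) (x : E) (v : E), coordField e a x = v ↔ e (coordForm e x v) = a :=
    fun a x v => ⟨fun h => by rw [← h, coordForm_coordField hg], fun h => by
      rw [← h, coordField_coordForm hg]⟩
  have smooth : ∀ a : L, SmoothOn (E := E) (M := E) (coordField e a) Set.univ := fun a =>
    contMDiffOn_vectorSpace_iff_contDiffOn.2 (contDiff_coordField hg e a).contDiffOn
  induction k using Nat.twoStepInduction with
  | zero =>
    intro x v
    rw [gradedFlag_zero, hg.zero, Submodule.mem_bot, LinearEquiv.map_eq_zero_iff]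
    constructor
    · intro h
      have h : v = 0 := h
      rw [h]; exact map_zero _
    · intro h
      exact coordForm_injective hg e x (h.trans (map_zero _).symm)
  | one =>
    intro x v
    rw [hg.gradedFlag_one]
    exact mem_standardDistribution
  | more i _ ih =>
    intro x v
    constructor
    -- In `θ[X, Y] = [θX, θY] + X(θY) - Y(θX)` the bracket term drops the degree by one. The
    -- derivative terms stay in the fixed subspaces in which `θX` and `θY` take their values.
    · let S : Submodule ℝ E := (gradedFlag g (i + 2)).comap (e.toLinearMap ∘ₗ (coordForm e x).toLinearMap)
      have hle : weakFlag (standardDistribution g e) (i + 2) x ≤ S := by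
        refine sup_le (fun w hw => gradedFlag_mono (Nat.le_succ _) ((ih x w).1 hw)) ?_
        refine Submodule.span_le.2 ?_
        rintro w ⟨X, Y, ⟨U, hU, hxU, hX, hXΔ⟩, ⟨V, hV, hxV, hY, hYΔ⟩, rfl⟩
        have hXd : ContDiffAt ℝ ∞ X x := hX.contDiffAt hU hxU
        have hYd : ContDiffAt ℝ ∞ Y x := hY.contDiffAt hV hxV
        have hθ : ContDiffAt ℝ ∞ (coordForm e) x := (contDiff_coordForm e).contDiffAt
        show e (coordForm e x (VectorField.mlieBracket 𝓘(ℝ, E) X Y x)) ∈ gradedFlag g (i + 2)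
        refine (congrArg (fun w : E => e (coordForm e x w) ∈ gradedFlag g (i + 2))
          (mlieBracket_eq_lieBracket X Y x)).mpr ?_
        have hform := coordForm_lieBracket hg e (hXd.differentiableAt (by simp))
          (hYd.differentiableAt (by simp))
        rw [hform, map_sub, map_add, coordBracket_apply, LinearEquiv.apply_symm_apply]
        have hXm : ∀ y ∈ U, e (coordForm e y (X y)) ∈ g 1 := fun y hy =>
          mem_standardDistribution.1 (hXΔ y hy)
        have hYm : ∀ y ∈ V, e (coordForm e y (Y y)) ∈ gradedFlag g (i + 1) := fun y hy =>
          (ih y _).1 (hYΔ y hy)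
        refine sub_mem (add_mem (hg.lie_mem_gradedFlag (hXm x hxU) (hYm x hxV)) ?_) ?_
        · have := fderiv_mem_of_eventually_mem (f := fun y => coordForm e y (Y y))
            (S := (gradedFlag g (i + 1)).comap e.toLinearMap)
            ((hθ.clm_apply hYd).differentiableAt (by simp))
            (Filter.eventually_of_mem (hV.mem_nhds hxV) hYm) (X x)
          exact gradedFlag_mono (Nat.le_succ _) this
        · have := fderiv_mem_of_eventually_mem (f := fun y => coordForm e y (X y))
            (S := (g 1).comap e.toLinearMap)
            ((hθ.clm_apply hXd).differentiableAt (by simp))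
            (Filter.eventually_of_mem (hU.mem_nhds hxU) hXm) (Y x)
          exact le_gradedFlag (by omega) this
      exact fun hv => hle hv
    · intro hv
      -- Evaluation of left-invariant fields at `x`, as a linear map in the algebra element; it
      -- suffices to treat the spanning brackets of `g (i + 2)`.
      let inv : L →ₗ[ℝ] E := (Ring.inverse (coordForm e x)).toLinearMap ∘ₗ e.symm.toLinearMap
      let S : Submodule ℝ L := Submodule.comap inv (weakFlag (standardDistribution g e) (i + 2) x)
      have hinv : ∀ a, inv a = coordField e a x := fun a => rfl
      suffices h : gradedFlag g (i + 2) ≤ S by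
        have h1 := h hv
        have h2 : inv (e (coordForm e x v)) = v := coordField_coordForm hg e x v
        have h3 : inv (e (coordForm e x v)) ∈ weakFlag (standardDistribution g e) (i + 2) x := h1
        rwa [h2] at h3
      rw [gradedFlag_succ, hg.eq_span_lie]
      refine sup_le (fun a ha => ?_) (Submodule.span_le.2 ?_)
      · refine (le_sup_left : weakFlag (standardDistribution g e) (i + 1) x ≤ _) ?_
        refine (ih x _).2 ?_
        rw [hinv, coordForm_coordField hg]
        exact ha
      · rintro _ ⟨a, ha, b, hb, rfl⟩
        refine (le_sup_right : _ ≤ weakFlag (standardDistribution g e) (i + 2) x) ?_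
        refine Submodule.subset_span ⟨coordField e a, coordField e b,
          ⟨Set.univ, isOpen_univ, trivial, smooth a, fun y _ => ?_⟩,
          ⟨Set.univ, isOpen_univ, trivial, smooth b, fun y _ => ?_⟩, ?_⟩
        · refine mem_standardDistribution.2 ?_
          rw [coordForm_coordField hg]; exact ha
        · refine (ih _ _).2 ?_
          rw [coordForm_coordField hg]; exact le_gradedFlag le_rfl hb
        · refine Eq.trans ?_ (mlieBracket_eq_lieBracket _ _ x).symm
          exact (field_mem _ _ _).2 (coordForm_lieBracket_coordField hg e a b x)

include hg in
theorem finrank_weakFlag_standardDistribution (k : ℕ) (x : E) :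
    Module.finrank ℝ (weakFlag (standardDistribution g e) k x) =
      Module.finrank ℝ (gradedFlag g k) := by
  let T : E ≃ₗ[ℝ] L := LinearEquiv.ofBijective (e.toLinearMap ∘ₗ (coordForm e x).toLinearMap)
    ⟨e.injective.comp (coordForm_injective hg e x), fun a =>
      ⟨coordField e a x, coordForm_coordField hg e a x⟩⟩
  have h : (weakFlag (standardDistribution g e) k x : Submodule ℝ E) =
      (gradedFlag g k).comap T.toLinearMap := by
    ext v
    exact mem_weakFlag_standardDistribution hg e k x v
  have h2 := LinearEquiv.finrank_map_eq T ((gradedFlag g k).comap T.toLinearMap)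
  rw [Submodule.map_comap_eq_of_surjective T.surjective, ← h] at h2
  exact h2.symm

include hg in
theorem isDistribution_standardDistribution {r : ℕ} (hr : Module.finrank ℝ (g 1) = r) :
    IsDistribution (standardDistribution g e) r := by
  have := hg.finite
  let b : Module.Basis (Fin r) ℝ (g 1) := Module.finBasisOfFinrankEq ℝ (g 1) hr
  intro p
  refine ⟨Set.univ, isOpen_univ, trivial, fun j => coordField e (b j : L), fun j =>
    contMDiffOn_vectorSpace_iff_contDiffOn.2 (contDiff_coordField hg e _).contDiffOn, ?_⟩
  intro x _
  let T : E ≃ₗ[ℝ] L := LinearEquiv.ofBijective (e.toLinearMap ∘ₗ (coordForm e x).toLinearMap)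
    ⟨e.injective.comp (coordForm_injective hg e x), fun a =>
      ⟨coordField e a x, coordForm_coordField hg e a x⟩⟩
  have hT : ∀ a, coordField e a x = T.symm a := fun a =>
    (LinearEquiv.eq_symm_apply T).2 (coordForm_coordField hg e a x)
  have hb : LinearIndependent ℝ (fun j => (b j : L)) :=
    b.linearIndependent.map' (g 1).subtype (Submodule.ker_subtype _)
  have hspan : Submodule.span ℝ (Set.range fun j => (b j : L)) = g 1 := by
    have := congrArg (Submodule.map (g 1).subtype) b.span_eq
    rw [Submodule.map_span, Submodule.map_top, Submodule.range_subtype, ← Set.range_comp] at this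
    exact this
  have h1 : LinearIndependent ℝ (fun j => coordField e (b j : L) x) := by
    simp only [hT]
    exact hb.map' T.symm.toLinearMap (LinearEquiv.ker _)
  have h2 : (standardDistribution g e x : Submodule ℝ E) =
      Submodule.span ℝ (Set.range fun j => coordField e (b j : L) x) := by
    have h3 : (Set.range fun j => coordField e (b j : L) x) =
        T.symm '' (Set.range fun j => (b j : L)) := by
      rw [← Set.range_comp]; simp only [hT]; rfl
    rw [h3, ← LinearEquiv.coe_coe, ← Submodule.map_span, hspan]
    ext v
    exact mem_standardDistribution.trans
      (Submodule.mem_map_equiv (e := T.symm) (p := g 1) (x := v)).symm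
  exact ⟨h1, h2⟩

end StandardModel
-- Invariance of the weak derived flag under local diffeomorphisms.
section Invariance

variable {E' : Type*} [NormedAddCommGroup E'] [NormedSpace ℝ E']
  {M' : Type*} [TopologicalSpace M'] [ChartedSpace E' M'] [IsManifold 𝓘(ℝ, E') ∞ M']
  {E'' : Type*} [NormedAddCommGroup E''] [NormedSpace ℝ E'']
  {M'' : Type*} [TopologicalSpace M''] [ChartedSpace E'' M''] [IsManifold 𝓘(ℝ, E'') ∞ M'']
  {E : Type*} [NormedAddCommGroup E] [NormedSpace ℝ E]
  {M : Type*} [TopologicalSpace M] [ChartedSpace E M] [IsManifold 𝓘(ℝ, E) ∞ M]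

/-- The diffeomorphism `φ` between open subsets carries `Δ` to `Δ'`. -/
structure Carries (φ : OpenPartialHomeomorph M M')
    (Δ : ∀ x : M, Submodule ℝ (TangentSpace 𝓘(ℝ, E) x))
    (Δ' : ∀ x : M', Submodule ℝ (TangentSpace 𝓘(ℝ, E') x)) : Prop where
  smooth : ContMDiffOn 𝓘(ℝ, E) 𝓘(ℝ, E') ∞ φ φ.source
  smooth_symm : ContMDiffOn 𝓘(ℝ, E') 𝓘(ℝ, E) ∞ φ.symm φ.target
  map_eq : ∀ x ∈ φ.source,
      Δ' (φ x) = (Δ x).map (mfderiv 𝓘(ℝ, E) 𝓘(ℝ, E') φ x).toLinearMap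

theorem locallyEquivalentAt_iff {Δ : ∀ x : M, Submodule ℝ (TangentSpace 𝓘(ℝ, E) x)} {p : M}
    {Δ' : ∀ x : M', Submodule ℝ (TangentSpace 𝓘(ℝ, E') x)} :
    LocallyEquivalentAt Δ p Δ' ↔
      ∃ φ : OpenPartialHomeomorph M M', p ∈ φ.source ∧ Carries φ Δ Δ' :=
  ⟨fun ⟨φ, hp, h1, h2, h3⟩ => ⟨φ, hp, h1, h2, h3⟩,
    fun ⟨φ, hp, h⟩ => ⟨φ, hp, h.smooth, h.smooth_symm, h.map_eq⟩⟩

namespace Carries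

variable {φ : OpenPartialHomeomorph M M'} {ψ : OpenPartialHomeomorph M' M''}
  {Δ : ∀ x : M, Submodule ℝ (TangentSpace 𝓘(ℝ, E) x)}
  {Δ' : ∀ x : M', Submodule ℝ (TangentSpace 𝓘(ℝ, E') x)}
  {Δ'' : ∀ x : M'', Submodule ℝ (TangentSpace 𝓘(ℝ, E'') x)}

theorem mdifferentiable (h : Carries φ Δ Δ') : φ.MDifferentiable 𝓘(ℝ, E) 𝓘(ℝ, E') :=
  ⟨h.smooth.mdifferentiableOn (by simp), h.smooth_symm.mdifferentiableOn (by simp)⟩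

theorem symm (h : Carries φ Δ Δ') : Carries φ.symm Δ' Δ := by
  refine ⟨h.smooth_symm, h.smooth, fun y hy => ?_⟩
  have hx : φ.symm y ∈ φ.source := φ.map_target hy
  have hmd := h.mdifferentiable
  have hyy : φ (φ.symm y) = y := φ.right_inv hy
  have h1 := h.map_eq _ hx
  have h2 := hmd.symm_comp_deriv hx
  rw [hyy] at h1 h2
  rw [h1]
  ext v
  rw [Submodule.mem_map]
  constructor
  · intro hv
    exact ⟨_, Submodule.mem_map_of_mem hv,
      congrArg (fun T : TangentSpace 𝓘(ℝ, E) (φ.symm y) →L[ℝ] TangentSpace 𝓘(ℝ, E) (φ.symm y) => T v) h2⟩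
  · rintro ⟨_, ⟨w, hw, rfl⟩, rfl⟩
    have := congrArg (fun T : TangentSpace 𝓘(ℝ, E) (φ.symm y) →L[ℝ] TangentSpace 𝓘(ℝ, E) (φ.symm y) => T w) h2
    exact (congrArg (· ∈ Δ (φ.symm y)) this).mpr hw

theorem trans (h : Carries φ Δ Δ') (h' : Carries ψ Δ' Δ'') : Carries (φ.trans ψ) Δ Δ'' := by
  refine ⟨?_, ?_, fun x hx => ?_⟩
  · rw [OpenPartialHomeomorph.coe_trans, OpenPartialHomeomorph.trans_source]
    exact h'.smooth.comp' h.smooth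
  · rw [OpenPartialHomeomorph.coe_trans_symm, OpenPartialHomeomorph.trans_target]
    exact h.smooth_symm.comp' h'.smooth_symm
  · rw [OpenPartialHomeomorph.trans_source] at hx
    have h1 := h.map_eq x hx.1
    have h2 := h'.map_eq (φ x) hx.2
    have h3 : mfderiv 𝓘(ℝ, E) 𝓘(ℝ, E'') (ψ ∘ φ) x = _ :=
      mfderiv_comp x (h'.mdifferentiable.mdifferentiableAt hx.2)
        (h.mdifferentiable.mdifferentiableAt hx.1)
    rw [h1, ← Submodule.map_comp] at h2
    rw [OpenPartialHomeomorph.coe_trans, h3]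
    exact h2

variable [CompleteSpace E] [CompleteSpace E']

theorem isInvertible (h : Carries φ Δ Δ') {x : M} (hx : x ∈ φ.source) :
    (mfderiv 𝓘(ℝ, E) 𝓘(ℝ, E') φ x).IsInvertible :=
  ⟨h.mdifferentiable.mfderiv hx, rfl⟩

theorem contMDiffAt (h : Carries φ Δ Δ') {x : M} (hx : x ∈ φ.source) :
    ContMDiffAt 𝓘(ℝ, E) 𝓘(ℝ, E') ∞ φ x :=
  h.smooth.contMDiffAt (φ.open_source.mem_nhds hx)

theorem isLocalSection_mpullback (h : Carries φ Δ Δ')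
    {D : ∀ x : M, Submodule ℝ (TangentSpace 𝓘(ℝ, E) x)}
    {D' : ∀ x : M', Submodule ℝ (TangentSpace 𝓘(ℝ, E') x)}
    (hD : ∀ x ∈ φ.source, ∀ v ∈ D' (φ x), (mfderiv 𝓘(ℝ, E) 𝓘(ℝ, E') φ x).inverse v ∈ D x)
    {x : M} (hx : x ∈ φ.source) {X : ∀ y : M', TangentSpace 𝓘(ℝ, E') y}
    (hX : IsLocalSection D' (φ x) X) :
    IsLocalSection D x (VectorField.mpullback 𝓘(ℝ, E) 𝓘(ℝ, E') φ X) := by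
  obtain ⟨U, hU, hxU, hXs, hXD⟩ := hX
  refine ⟨φ.source ∩ φ ⁻¹' U, φ.isOpen_inter_preimage hU, ⟨hx, hxU⟩, fun y hy => ?_, fun y hy => ?_⟩
  · have h1 := hXs.contMDiffAt (hU.mem_nhds hy.2)
    exact (ContMDiffAt.mpullback_vectorField_preimage h1 (h.contMDiffAt hy.1)
      (h.isInvertible hy.1) (by simp)).contMDiffWithinAt
  · exact hD y hy.1 _ (hXD _ hy.2)

/-- Pullback of vector fields preserves local sections and commutes with the Lie bracket, so the
inclusion passes up the flag. The reverse inequality of ranks comes from applying this to `φ.symm`.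
-/
theorem inverse_mem_weakFlag (h : Carries φ Δ Δ') (k : ℕ) :
    ∀ x ∈ φ.source, ∀ v ∈ weakFlag Δ' k (φ x),
      (mfderiv 𝓘(ℝ, E) 𝓘(ℝ, E') φ x).inverse v ∈ weakFlag Δ k x := by
  have h1 : ∀ x ∈ φ.source, ∀ v ∈ Δ' (φ x),
      (mfderiv 𝓘(ℝ, E) 𝓘(ℝ, E') φ x).inverse v ∈ Δ x := by
    intro x hx v hv
    rw [h.map_eq x hx] at hv
    obtain ⟨w, hw, rfl⟩ := hv
    have := (h.isInvertible hx).inverse_apply_eq (y := mfderiv 𝓘(ℝ, E) 𝓘(ℝ, E') φ x w) (x := w)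
    rw [show (mfderiv 𝓘(ℝ, E) 𝓘(ℝ, E') φ x).inverse
      ((mfderiv 𝓘(ℝ, E) 𝓘(ℝ, E') φ x).toLinearMap w) = w from this.2 rfl]
    exact hw
  induction k using Nat.twoStepInduction with
  | zero =>
    intro x hx v hv
    have hv : v = 0 := hv
    rw [hv, map_zero]
    exact zero_mem _
  | one => exact h1
  | more i _ ih =>
    intro x hx
    have hle : weakFlag Δ' (i + 2) (φ x) ≤
        (weakFlag Δ (i + 2) x).comap (mfderiv 𝓘(ℝ, E) 𝓘(ℝ, E') φ x).inverse.toLinearMap := by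
      refine sup_le (fun v hv => (le_sup_left : weakFlag Δ (i + 1) x ≤ _) (ih x hx v hv)) ?_
      refine Submodule.span_le.2 ?_
      rintro _ ⟨X, Y, hX, hY, rfl⟩
      refine (le_sup_right : _ ≤ weakFlag Δ (i + 2) x) ?_
      refine Submodule.subset_span ⟨_, _, h.isLocalSection_mpullback h1 hx hX,
        h.isLocalSection_mpullback ih hx hY, ?_⟩
      have hmd : ∀ {D' : ∀ x : M', Submodule ℝ (TangentSpace 𝓘(ℝ, E') x)}
          {X : ∀ y : M', TangentSpace 𝓘(ℝ, E') y}, IsLocalSection D' (φ x) X →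
          MDifferentiableAt 𝓘(ℝ, E') (𝓘(ℝ, E')).tangent
            (fun y => (⟨y, X y⟩ : TangentBundle 𝓘(ℝ, E') M')) (φ x) := by
        rintro D' X ⟨U, hU, hxU, hXs, -⟩
        exact (hXs.contMDiffAt (hU.mem_nhds hxU)).mdifferentiableAt (by simp)
      have : IsManifold 𝓘(ℝ, E) (minSmoothness ℝ 2) M := by
        rw [minSmoothness_of_isRCLikeNormedField]; infer_instance
      have : IsManifold 𝓘(ℝ, E') (minSmoothness ℝ 2) M' := by
        rw [minSmoothness_of_isRCLikeNormedField]; infer_instance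
      exact VectorField.mpullback_mlieBracket (hmd hX) (hmd hY) (h.contMDiffAt hx)
        (by rw [minSmoothness_of_isRCLikeNormedField]; norm_cast)
    exact fun v hv => hle hv

theorem finrank_weakFlag_le [FiniteDimensional ℝ E] (h : Carries φ Δ Δ') (k : ℕ) {x : M}
    (hx : x ∈ φ.source) :
    Module.finrank ℝ (weakFlag Δ' k (φ x)) ≤ Module.finrank ℝ (weakFlag Δ k x) := by
  obtain ⟨T, hT⟩ := h.isInvertible hx
  have hinv : ∀ v, (mfderiv 𝓘(ℝ, E) 𝓘(ℝ, E') φ x).inverse v = T.symm v := fun v => by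
    rw [← hT, ContinuousLinearMap.inverse_equiv]; rfl
  have hle : (weakFlag Δ' k (φ x)).map T.symm.toLinearEquiv.toLinearMap ≤ weakFlag Δ k x := by
    rintro _ ⟨v, hv, rfl⟩
    have := h.inverse_mem_weakFlag k x hx v hv
    rwa [hinv] at this
  have : FiniteDimensional ℝ (TangentSpace 𝓘(ℝ, E) x) := inferInstanceAs (FiniteDimensional ℝ E)
  rw [← LinearEquiv.finrank_map_eq T.symm.toLinearEquiv (weakFlag Δ' k (φ x))]
  exact Submodule.finrank_mono hle

theorem finrank_weakFlag_eq [FiniteDimensional ℝ E] [FiniteDimensional ℝ E'] (h : Carries φ Δ Δ')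
    (k : ℕ) {x : M} (hx : x ∈ φ.source) :
    Module.finrank ℝ (weakFlag Δ' k (φ x)) = Module.finrank ℝ (weakFlag Δ k x) := by
  refine le_antisymm (h.finrank_weakFlag_le k hx) ?_
  have := h.symm.finrank_weakFlag_le k (φ.map_source hx)
  rwa [φ.left_inv hx] at this

end Carries
end Invariance
-- Quotients by one component, and the integrable extensions they induce.
section GradedQuotient

variable {L' : Type*} [LieRing L'] [LieAlgebra ℝ L'] {g' : ℕ → Submodule ℝ L'}
  {L : Type*} [LieRing L] [LieAlgebra ℝ L] {g : ℕ → Submodule ℝ L}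

/-- The component of lowest degree as an ideal. -/
def IsFundamentalGNLA.bottomIdeal (hg : IsFundamentalGNLA g) (μ : ℕ)
    (hμ : ∀ i, μ < i → g i = ⊥) : LieIdeal ℝ L :=
  { g μ with
    lie_mem := by
      intro x y hy
      have h : ⁅x, y⁆ ∈ ⨆ i ∈ Set.Ici (μ + 1), g i :=
        hg.lie_mem_biSup_Ici x (le_biSup g (Set.mem_Ici.2 le_rfl) hy)
      have hbot : (⨆ i ∈ Set.Ici (μ + 1), g i) ≤ ⊥ :=
        iSup₂_le fun i hi => (hμ i hi).le
      have h0 : ⁅x, y⁆ = 0 := hbot h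
      rw [h0]
      exact (g μ).zero_mem }

theorem IsFundamentalGNLA.map (hg : IsFundamentalGNLA g) (f : L →ₗ⁅ℝ⁆ L')
    (hf : Function.Surjective f) {μ : ℕ} (hker : ∀ x, f x = 0 ↔ x ∈ g μ) :
    IsFundamentalGNLA fun i => (g i).map f.toLinearMap where
  finite := by
    have := hg.finite
    exact Module.Finite.of_surjective f.toLinearMap hf
  zero := by rw [hg.zero, Submodule.map_bot]
  internal := by
    refine DirectSum.isInternal_submodule_of_iSupIndep_of_iSup_eq_top ?_ ?_
    · intro i
      rw [Submodule.disjoint_def]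
      rintro _ ⟨a, ha, rfl⟩ hb
      simp only [← Submodule.map_iSup] at hb
      obtain ⟨b, hb, hab⟩ := hb
      have hsub : a - b ∈ g μ := (hker _).1 (by
        rw [map_sub, sub_eq_zero]; exact hab.symm)
      -- The component `g μ` has zero image; for any other index the kernel lies among the remaining
      -- summands, so independence upstairs applies.
      by_cases hi : i = μ
      · subst hi
        exact (hker a).2 ha
      · have h1 : a - b ∈ ⨆ j, ⨆ (_ : j ≠ i), g j :=
          (le_iSup₂_of_le (f := fun j (_ : j ≠ i) => g j) μ (Ne.symm hi) le_rfl) hsub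
        have h2 : a ∈ ⨆ j, ⨆ (_ : j ≠ i), g j := by
          have := add_mem h1 hb
          rwa [sub_add_cancel] at this
        rw [Submodule.disjoint_def.1 (hg.indep i) a ha h2]
        exact map_zero _
    · rw [← Submodule.map_iSup, hg.iSup_eq_top, Submodule.map_top]
      exact LinearMap.range_eq_top.2 hf
  lie_mem := by
    rintro i j _ _ ⟨x, hx, rfl⟩ ⟨y, hy, rfl⟩
    exact ⟨⁅x, y⁆, hg.lie_mem i j x y hx hy, LieHom.map_lie f x y⟩
  generates := by
    rw [eq_top_iff]
    have h := hg.generates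
    intro y _
    obtain ⟨x, rfl⟩ := hf y
    have hx : x ∈ LieSubalgebra.lieSpan ℝ L (g 1 : Set L) := by rw [h]; trivial
    induction hx using LieSubalgebra.lieSpan_induction with
    | mem x hx => exact LieSubalgebra.subset_lieSpan ⟨x, hx, rfl⟩
    | zero => rw [map_zero]; exact zero_mem _
    | add a b _ _ ha hb => rw [map_add]; exact add_mem (ha trivial) (hb trivial)
    | smul c a _ ha => rw [map_smul]; exact LieSubalgebra.smul_mem _ c (ha trivial)
    | lie a b _ _ ha hb => rw [LieHom.map_lie]; exact LieSubalgebra.lie_mem _ (ha trivial) (hb trivial)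

/-- The two sums are truncated at different dimensions; the extra terms upstairs map to zero because
`L'` is nilpotent. -/
theorem map_maurerCartan [FiniteDimensional ℝ L] (hg' : IsFundamentalGNLA g') (f : L →ₗ⁅ℝ⁆ L')
    (hf : Function.Surjective f) (x v : L) : f (maurerCartan x v) = maurerCartan (f x) (f v) := by
  have hpow : ∀ k, f (((LieAlgebra.ad ℝ L x) ^ k) v) = ((LieAlgebra.ad ℝ L' (f x)) ^ k) (f v) := by
    intro k
    induction k with
    | zero => simp
    | succ k ih => simp only [pow_succ', Module.End.mul_apply, LieAlgebra.ad_apply, LieHom.map_lie, ih]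
  have hle : Module.finrank ℝ L' ≤ Module.finrank ℝ L :=
    LinearMap.finrank_le_finrank_of_surjective (f := f.toLinearMap) hf
  simp only [maurerCartan, LinearMap.coe_sum, Finset.sum_apply, LinearMap.smul_apply, map_sum,
    map_smul, hpow]
  symm
  refine Finset.sum_subset (Finset.range_mono hle) fun k _ hk => ?_
  have h0 : (LieAlgebra.ad ℝ L' (f x)) ^ k = 0 :=
    pow_eq_zero_of_le (not_lt.1 fun h => hk (Finset.mem_range.2 h)) (hg'.ad_pow_finrank (f x))
  rw [h0, LinearMap.zero_apply, smul_zero]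

variable {E' : Type*} [NormedAddCommGroup E'] [NormedSpace ℝ E'] [FiniteDimensional ℝ E']
  {E : Type*} [NormedAddCommGroup E] [NormedSpace ℝ E] [FiniteDimensional ℝ E]

/-- A homomorphism in linear coordinates. -/
noncomputable def coordHom (f : L →ₗ⁅ℝ⁆ L') (e : E ≃ₗ[ℝ] L) (e' : E' ≃ₗ[ℝ] L') : E →L[ℝ] E' :=
  (e'.symm.toLinearMap ∘ₗ f.toLinearMap ∘ₗ e.toLinearMap).toContinuousLinearMap

theorem apply_coordHom (f : L →ₗ⁅ℝ⁆ L') (e : E ≃ₗ[ℝ] L) (e' : E' ≃ₗ[ℝ] L') (x : E) :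
    e' (coordHom f e e' x) = f (e x) :=
  e'.apply_symm_apply _

variable (hg : IsFundamentalGNLA g) (hg' : IsFundamentalGNLA g') {f : L →ₗ⁅ℝ⁆ L'}
  (hf : Function.Surjective f) (hmap : ∀ i, g' i = (g i).map f.toLinearMap)
  {μ : ℕ} (hμ : 2 < μ) (hker : ∀ x, f x = 0 ↔ x ∈ g μ) (e : E ≃ₗ[ℝ] L) (e' : E' ≃ₗ[ℝ] L')

include hg hg' hf in
theorem coordForm_coordHom (x v : E) :
    e' (coordForm e' (coordHom f e e' x) (coordHom f e e' v)) = f (e (coordForm e x v)) := by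
  have := hg.finite
  rw [coordForm_apply, coordForm_apply, apply_coordHom, apply_coordHom, map_maurerCartan hg' f hf]

include hg hg' hf hker in
theorem coordHom_eq_zero_iff (x v : E) :
    coordHom f e e' v = 0 ↔ e (coordForm e x v) ∈ g μ := by
  rw [← hker, ← coordForm_coordHom hg hg' hf e e', LinearEquiv.map_eq_zero_iff]
  exact ⟨fun h => by rw [h, map_zero], fun h => coordForm_injective hg' e' _ (h.trans (map_zero _).symm)⟩

variable {Δ : ∀ x : E', Submodule ℝ (TangentSpace 𝓘(ℝ, E') x)} {Φ : E' ≃ₜ E'}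
  (hΦ : Carries (E := E') (E' := E') Φ.toOpenPartialHomeomorph (standardDistribution g' e') Δ)

include hΦ in
theorem mfderiv_comp_coordHom (x v : E) :
    mfderiv 𝓘(ℝ, E) 𝓘(ℝ, E') (Φ ∘ coordHom f e e') x v =
      mfderiv 𝓘(ℝ, E') 𝓘(ℝ, E') Φ (coordHom f e e' x) (coordHom f e e' v) := by
  have h1 : MDifferentiableAt 𝓘(ℝ, E') 𝓘(ℝ, E') Φ (coordHom f e e' x) :=
    hΦ.mdifferentiable.mdifferentiableAt (Set.mem_univ _)
  have h2 : MDifferentiableAt 𝓘(ℝ, E) 𝓘(ℝ, E') (coordHom f e e') x :=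
    (coordHom f e e').differentiableAt.mdifferentiableAt
  rw [mfderiv_comp x h1 h2, mfderiv_eq_fderiv (f := coordHom f e e'), ContinuousLinearMap.fderiv]
  rfl

include hΦ in
theorem mfderiv_bijective_of_carries (y : E') :
    Function.Bijective (mfderiv 𝓘(ℝ, E') 𝓘(ℝ, E') Φ y) :=
  hΦ.mdifferentiable.mfderiv_bijective (Set.mem_univ y)

include hg hg' hf hker hΦ in
theorem mem_ker_mfderiv_comp_coordHom (x v : E) :
    mfderiv 𝓘(ℝ, E) 𝓘(ℝ, E') (Φ ∘ coordHom f e e') x v = 0 ↔ e (coordForm e x v) ∈ g μ := by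
  rw [← coordHom_eq_zero_iff hg hg' hf hker e e' x v, mfderiv_comp_coordHom e e' hΦ]
  have hb := (mfderiv_bijective_of_carries e' hΦ (coordHom f e e' x)).injective
  exact ⟨fun h => hb (h.trans (map_zero _).symm), fun h => (congrArg _ h).trans (map_zero _)⟩

include hg hg' hf hker hΦ in
-- Fibre directions are left translates of `g μ`, which is independent of the components of smaller
-- index. This yields injectivity on the distribution (`k = 1`), horizontality (`k = 2`) and half of
-- the pure grading (`k = μ - 1`).
theorem weakFlag_inf_ker_mfderiv {k : ℕ} (hk : k < μ) (x : E) :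
    weakFlag (standardDistribution g e) k x ⊓
      (mfderiv 𝓘(ℝ, E) 𝓘(ℝ, E') (Φ ∘ coordHom f e e') x).toLinearMap.ker = ⊥ := by
  rw [eq_bot_iff]
  rintro v ⟨hv1, hv2⟩
  have h1 := (mem_weakFlag_standardDistribution hg e k x v).1 hv1
  have h2 := (mem_ker_mfderiv_comp_coordHom hg hg' hf hker e e' hΦ x v).1 hv2
  have h3 := Submodule.disjoint_def.1 (hg.disjoint_gradedFlag hk) _ h2 h1
  rw [LinearEquiv.map_eq_zero_iff] at h3
  exact coordForm_injective hg e x (h3.trans (map_zero _).symm)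

include hg hg' hf hmap hμ hker hΦ in
-- The projection is the homomorphism in exponential coordinates followed by `Φ`. The map `Φ` is
-- needed because the distribution below may be the Hilbert–Cartan one instead of a standard model.
theorem isIntegrableExtension_comp_coordHom :
    IsIntegrableExtension (Φ ∘ coordHom f e e') (standardDistribution g e) Δ where
  smooth := by
    have h : ContMDiff 𝓘(ℝ, E') 𝓘(ℝ, E') ∞ Φ := contMDiffOn_univ.1 hΦ.smooth
    exact h.comp (coordHom f e e').contDiff.contMDiff
  surjective := by
    refine Φ.surjective.comp fun y => ?_
    obtain ⟨x, hx⟩ := hf (e' y)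
    refine ⟨e.symm x, e'.injective ?_⟩
    rw [apply_coordHom, LinearEquiv.apply_symm_apply, hx]
  submersion := by
    intro x w
    obtain ⟨y, rfl⟩ := (mfderiv_bijective_of_carries e' hΦ (coordHom f e e' x)).surjective w
    obtain ⟨a, ha⟩ := hf (e' y)
    refine ⟨(e.symm a : E), ?_⟩
    refine (mfderiv_comp_coordHom e e' hΦ x _).trans (congrArg _ (e'.injective ?_))
    rw [apply_coordHom, LinearEquiv.apply_symm_apply, ha]
  bijOn := by
    intro x
    have hΔ : Δ (Φ (coordHom f e e' x)) = _ := hΦ.map_eq (coordHom f e e' x) (Set.mem_univ _)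
    refine ⟨fun v hv => ?_, fun v hv w hw hvw => ?_, fun w hw => ?_⟩
    · have h1 : e (coordForm e x v) ∈ g 1 := mem_standardDistribution.1 hv
      refine (congrArg (_ ∈ ·) hΔ).mpr ⟨coordHom f e e' v, ?_, ?_⟩
      · refine mem_standardDistribution.2 ?_
        refine (congrArg (· ∈ g' 1) (coordForm_coordHom hg hg' hf e e' x v)).mpr ?_
        rw [hmap]
        exact Submodule.mem_map_of_mem h1
      · exact (mfderiv_comp_coordHom e e' hΦ x v).symm
    · have h1 : v - w ∈ standardDistribution g e x := sub_mem hv hw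
      have h2 : mfderiv 𝓘(ℝ, E) 𝓘(ℝ, E') (Φ ∘ coordHom f e e') x (v - w) = 0 := by
        rw [map_sub, hvw, sub_self]
      have h3 := weakFlag_inf_ker_mfderiv hg hg' hf hker e e' hΦ (show 1 < μ by omega) x
      have h4 : v - w ∈ (⊥ : Submodule ℝ (TangentSpace 𝓘(ℝ, E) x)) := by
        rw [← h3]; exact ⟨h1, h2⟩
      exact sub_eq_zero.1 h4
    · obtain ⟨y, hy, rfl⟩ := (congrArg (w ∈ ·) hΔ).mp hw
      have h1 : e' (coordForm e' (coordHom f e e' x) y) ∈ g' 1 := mem_standardDistribution.1 hy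
      rw [hmap] at h1
      obtain ⟨a, ha, hay⟩ := h1
      -- A horizontal lift is found on the algebra, where `g 1` maps onto `g' 1`, and translated
      -- back to `x`.
      obtain ⟨u, hu⟩ : ∃ u : E, e (coordForm e x u) = a := ⟨_, coordForm_coordField hg e a x⟩
      refine ⟨u, mem_standardDistribution.2 ((congrArg (· ∈ g 1) hu).mpr ha), ?_⟩
      refine (mfderiv_comp_coordHom e e' hΦ x u).trans (congrArg _ ?_)
      refine coordForm_injective hg' e' (coordHom f e e' x) (e'.injective ?_)
      exact ((coordForm_coordHom hg hg' hf e e' x u).trans (congrArg f hu)).trans hay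
  horizontal := fun x => weakFlag_inf_ker_mfderiv hg hg' hf hker e e' hΦ hμ x

include hg hg' hf hμ hker hΦ in
theorem hasPureGrading_comp_coordHom :
    HasPureGrading (E := E') (Φ ∘ coordHom f e e') (standardDistribution g e) μ := by
  refine fun x => ⟨fun v hv => ?_, weakFlag_inf_ker_mfderiv hg hg' hf hker e e' hΦ (by omega) x⟩
  refine (mem_weakFlag_standardDistribution hg e μ x v).2 (le_gradedFlag le_rfl ?_)
  exact (mem_ker_mfderiv_comp_coordHom hg hg' hf hker e e' hΦ x v).1 hv

include hg in
theorem completelyNonholonomic_standardDistribution :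
    CompletelyNonholonomic (standardDistribution g e) := by
  obtain ⟨μ, hμ⟩ := hg.exists_eq_bot
  refine ⟨μ, fun x => eq_top_iff.2 fun v _ => ?_⟩
  refine (mem_weakFlag_standardDistribution hg e μ x v).2 ?_
  rw [hg.gradedFlag_eq_top hμ]
  trivial

end GradedQuotient

/-! ### The identity as an equivalence. -/

section Refl

variable {E : Type*} [NormedAddCommGroup E] [NormedSpace ℝ E]

theorem carries_refl (Δ : ∀ x : E, Submodule ℝ (TangentSpace 𝓘(ℝ, E) x)) :
    Carries (E := E) (E' := E) (Homeomorph.refl E).toOpenPartialHomeomorph Δ Δ where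
  smooth := contMDiffOn_id
  smooth_symm := contMDiffOn_id
  map_eq := by
    intro x _
    have h : mfderiv 𝓘(ℝ, E) 𝓘(ℝ, E) (Homeomorph.refl E) x = ContinuousLinearMap.id ℝ _ := mfderiv_id
    exact ((congrArg (fun T : TangentSpace 𝓘(ℝ, E) x →L[ℝ] TangentSpace 𝓘(ℝ, E) x =>
      (Δ x).map T.toLinearMap) h).trans (Submodule.map_id _)).symm

end Refl
-- Equivalences from global diffeomorphisms of vector spaces.
section CarriesBuilder

variable {E : Type*} [NormedAddCommGroup E] [NormedSpace ℝ E]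
  {E' : Type*} [NormedAddCommGroup E'] [NormedSpace ℝ E']

theorem carries_of_homeomorph (Φ : E ≃ₜ E') (hΦ : ContDiff ℝ ∞ Φ) (hΦ' : ContDiff ℝ ∞ Φ.symm)
    {Δ : ∀ x : E, Submodule ℝ (TangentSpace 𝓘(ℝ, E) x)}
    {Δ' : ∀ x : E', Submodule ℝ (TangentSpace 𝓘(ℝ, E') x)}
    (h : ∀ x v : E, v ∈ Δ x ↔ fderiv ℝ Φ x v ∈ Δ' (Φ x)) :
    Carries (E := E) (E' := E') Φ.toOpenPartialHomeomorph Δ Δ' := by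
  have h1 : ContMDiffOn 𝓘(ℝ, E) 𝓘(ℝ, E') ∞ Φ.toOpenPartialHomeomorph
      Φ.toOpenPartialHomeomorph.source := hΦ.contMDiff.contMDiffOn
  have h2 : ContMDiffOn 𝓘(ℝ, E') 𝓘(ℝ, E) ∞ Φ.toOpenPartialHomeomorph.symm
      Φ.toOpenPartialHomeomorph.target := hΦ'.contMDiff.contMDiffOn
  refine ⟨h1, h2, fun x hx => ?_⟩
  have hmd : Φ.toOpenPartialHomeomorph.MDifferentiable 𝓘(ℝ, E) 𝓘(ℝ, E') :=
    ⟨h1.mdifferentiableOn (by simp), h2.mdifferentiableOn (by simp)⟩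
  have hfd : mfderiv 𝓘(ℝ, E) 𝓘(ℝ, E') Φ.toOpenPartialHomeomorph x = fderiv ℝ Φ x :=
    mfderiv_eq_fderiv
  ext w
  constructor
  · intro hw
    obtain ⟨v, rfl⟩ := hmd.mfderiv_surjective hx w
    refine Submodule.mem_map_of_mem ((h x v).2 ?_)
    exact (congrArg (fun T : E →L[ℝ] E' => (T v : E') ∈ Δ' (Φ x)) hfd).mp hw
  · rintro ⟨v, hv, rfl⟩
    exact (congrArg (fun T : E →L[ℝ] E' => (T v : E') ∈ Δ' (Φ x)) hfd).mpr ((h x v).1 hv)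

end CarriesBuilder

/-! ### The Hilbert–Cartan equation in coordinates. -/

section HilbertCartan

theorem mem_hilbertCartan (p w : EuclideanSpace ℝ (Fin 5)) :
    w ∈ (hilbertCartan p : Submodule ℝ (EuclideanSpace ℝ (Fin 5))) ↔
      w 1 = p 4 ^ 2 * w 0 ∧ w 2 = p 3 * w 0 ∧ w 3 = p 4 * w 0 := by
  have h0 : (hilbertCartan p : Submodule ℝ (EuclideanSpace ℝ (Fin 5))) =
      Submodule.span ℝ {!₂[1, p 4 ^ 2, p 3, p 4, 0], !₂[0, 0, 0, 0, 1]} := by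
    have h1 : (totalDerivative (N := 3) (fun p i => if i.val + 1 = 1 then (p 4) ^ 2 else p i.succ.succ) p :
        EuclideanSpace ℝ (Fin 5))
        = !₂[1, p 4 ^ 2, p 3, p 4, 0] := by
      ext i; fin_cases i <;> rfl
    have h2 : (lastVector 3 : EuclideanSpace ℝ (Fin 5)) = !₂[0, 0, 0, 0, 1] := by
      ext i; fin_cases i <;> simp [lastVector, Fin.last]
    rw [← h1, ← h2]; rfl
  refine ((iff_of_eq (congrArg (fun S : Submodule ℝ (EuclideanSpace ℝ (Fin 5)) => w ∈ S) h0)).trans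
    Submodule.mem_span_pair).trans ?_
  constructor
  · rintro ⟨a, b, rfl⟩
    simp [mul_comm]
  · rintro ⟨h1, h2, h3⟩
    refine ⟨w 0, w 4, ?_⟩
    ext i; fin_cases i <;> simp [h1, h2, h3, mul_comm]

/-- The exponential coordinates of the free nilpotent Lie group of type `(2, 1, 2)` expressed by
the jet coordinates of the Hilbert-Cartan equation. -/
noncomputable def hilbertCartanChart : EuclideanSpace ℝ (Fin 5) ≃ₜ EuclideanSpace ℝ (Fin 5) where
  toFun x := !₂[x 0, x 0 * x 1 ^ 2 / 3 - x 1 * x 2 - 2 * x 4,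
    x 0 ^ 2 * x 1 / 6 - x 0 * x 2 / 2 + x 3, x 0 * x 1 / 2 - x 2, x 1]
  invFun p := !₂[p 0, p 4, p 0 * p 4 / 2 - p 3, p 2 + p 0 ^ 2 * p 4 / 12 - p 0 * p 3 / 2,
    (p 3 * p 4 - p 0 * p 4 ^ 2 / 6 - p 1) / 2]
  left_inv x := by
    ext i; fin_cases i <;> simp <;> ring
  right_inv x := by
    ext i; fin_cases i <;> simp <;> ring
  continuous_toFun := by
    refine (PiLp.continuous_toLp 2 _).comp (continuous_pi fun i => ?_)
    fin_cases i <;> simp <;> fun_prop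
  continuous_invFun := by
    refine (PiLp.continuous_toLp 2 _).comp (continuous_pi fun i => ?_)
    fin_cases i <;> simp <;> fun_prop

theorem contDiff_hilbertCartanChart : ContDiff ℝ ∞ hilbertCartanChart := by
  rw [contDiff_euclidean]
  intro i
  fin_cases i <;> simp [hilbertCartanChart] <;> fun_prop

theorem contDiff_hilbertCartanChart_symm : ContDiff ℝ ∞ hilbertCartanChart.symm := by
  rw [contDiff_euclidean]
  intro i
  fin_cases i <;> simp [hilbertCartanChart, Homeomorph.symm] <;> fun_prop

theorem fderiv_hilbertCartanChart (x v : EuclideanSpace ℝ (Fin 5)) :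
    fderiv ℝ hilbertCartanChart x v = !₂[v 0,
      (v 0 * x 1 ^ 2 + 2 * x 0 * x 1 * v 1) / 3 - (v 1 * x 2 + x 1 * v 2) - 2 * v 4,
      (2 * x 0 * v 0 * x 1 + x 0 ^ 2 * v 1) / 6 - (v 0 * x 2 + x 0 * v 2) / 2 + v 3,
      (v 0 * x 1 + x 0 * v 1) / 2 - v 2, v 1] := by
  have hx : ∀ i, HasDerivAt (fun t : ℝ => x i + t * v i) (v i) 0 := fun i => by
    simpa using ((hasDerivAt_id (0 : ℝ)).mul_const (v i)).const_add (x i)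
  have hline : HasDerivAt (fun t : ℝ => x + t • v) v 0 := by
    simpa using ((hasDerivAt_id (0 : ℝ)).smul_const v).const_add x
  have hd : HasFDerivAt hilbertCartanChart (fderiv ℝ hilbertCartanChart x) (x + (0 : ℝ) • v) := by
    simpa using (contDiff_hilbertCartanChart.differentiable (by simp) x).hasFDerivAt
  have h1 : HasDerivAt (fun t : ℝ => hilbertCartanChart (x + t • v))
    (fderiv ℝ hilbertCartanChart x v) 0 := hd.comp_hasDerivAt 0 hline
  ext i
  have h2 : HasDerivAt (fun t : ℝ => hilbertCartanChart (x + t • v) i)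
      (fderiv ℝ hilbertCartanChart x v i) 0 :=
    (EuclideanSpace.proj i : EuclideanSpace ℝ (Fin 5) →L[ℝ] ℝ).hasFDerivAt.comp_hasDerivAt 0 h1
  refine h2.unique ?_
  clear h1 h2 hd hline
  fin_cases i
  · simpa [hilbertCartanChart] using hx 0
  · have := ((((hx 0).fun_mul ((hx 1).fun_pow 2)).div_const 3).fun_sub ((hx 1).fun_mul (hx 2))).fun_sub
      ((hx 4).const_mul 2)
    refine this.congr_deriv ?_
    simp; ring
  · have := (((((hx 0).fun_pow 2).fun_mul (hx 1)).div_const 6).fun_sub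
      (((hx 0).fun_mul (hx 2)).div_const 2)).fun_add (hx 3)
    refine this.congr_deriv ?_
    simp
  · have := (((hx 0).fun_mul (hx 1)).div_const 2).fun_sub (hx 2)
    refine this.congr_deriv ?_
    simp
  · simpa [hilbertCartanChart] using hx 1

end HilbertCartan

/-! ### The free nilpotent algebra of type (2, 1, 2) and its model. -/

section FreeNilpotent

variable {L : Type*} [LieRing L] [LieAlgebra ℝ L] {g : ℕ → Submodule ℝ L}

/-- The bracket of the free nilpotent Lie algebra of type `(2, 1, 2)`. -/
noncomputable def freeBracket (x v : EuclideanSpace ℝ (Fin 5)) : EuclideanSpace ℝ (Fin 5) :=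
  !₂[0, 0, x 0 * v 1 - x 1 * v 0, x 0 * v 2 - x 2 * v 0, x 1 * v 2 - x 2 * v 1]

theorem IsFundamentalGNLA.finrank_eq_of_growth (hg : IsFundamentalGNLA g)
    (h1 : Module.finrank ℝ (g 1) = 2) (h2 : Module.finrank ℝ (g 2) = 1)
    (h3 : Module.finrank ℝ (g 3) = 2) (hμ : ∀ i, 3 < i → g i = ⊥) : Module.finrank ℝ L = 5 := by
  have ht := hg.gradedFlag_eq_top hμ
  have e3 := hg.finrank_gradedFlag_succ 2
  have e2 := hg.finrank_gradedFlag_succ 1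
  rw [hg.gradedFlag_one] at e2
  rw [← finrank_top, ← ht, e3, e2, h1, h2, h3]

/-- Generators of the components of degree at least `-3`. -/
theorem IsFundamentalGNLA.exists_generators (hg : IsFundamentalGNLA g)
    (h1 : Module.finrank ℝ (g 1) = 2) :
    ∃ a1 a2 : L, a1 ∈ g 1 ∧ a2 ∈ g 1 ∧ (∀ x ∈ g 1, ∃ c d : ℝ, x = c • a1 + d • a2) ∧
      g 2 ≤ Submodule.span ℝ {⁅a1, a2⁆} ∧
      g 3 ≤ Submodule.span ℝ {⁅a1, ⁅a1, a2⁆⁆, ⁅a2, ⁅a1, a2⁆⁆} := by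
  have hfin := hg.finite
  let b1 : Module.Basis (Fin 2) ℝ (g 1) := Module.finBasisOfFinrankEq ℝ (g 1) h1
  set a1 : L := (b1 0 : L)
  set a2 : L := (b1 1 : L)
  have m1 : a1 ∈ g 1 := (b1 0).2
  have m2 : a2 ∈ g 1 := (b1 1).2
  have s1 : ∀ x ∈ g 1, ∃ c d : ℝ, x = c • a1 + d • a2 := fun x hx => by
    have := b1.sum_repr ⟨x, hx⟩
    rw [Fin.sum_univ_two] at this
    exact ⟨_, _, (congrArg Subtype.val this).symm⟩
  have h21 : ⁅a2, a1⁆ = -⁅a1, a2⁆ := (lie_skew a2 a1).symm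
  have s2 : g 2 ≤ Submodule.span ℝ {⁅a1, a2⁆} := by
    rw [hg.eq_span_lie 0, Submodule.span_le]
    rintro _ ⟨x, hx, y, hy, rfl⟩
    obtain ⟨c, d, rfl⟩ := s1 x hx
    obtain ⟨c', d', rfl⟩ := s1 y hy
    refine Submodule.mem_span_singleton.2 ⟨c * d' - d * c', ?_⟩
    simp only [add_lie, lie_add, smul_lie, lie_smul, lie_self, h21]
    module
  have s3 : g 3 ≤ Submodule.span ℝ {⁅a1, ⁅a1, a2⁆⁆, ⁅a2, ⁅a1, a2⁆⁆} := by
    rw [hg.eq_span_lie 1, Submodule.span_le]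
    rintro _ ⟨x, hx, y, hy, rfl⟩
    obtain ⟨c, d, rfl⟩ := s1 x hx
    obtain ⟨c', rfl⟩ := Submodule.mem_span_singleton.1 (s2 hy)
    refine Submodule.mem_span_pair.2 ⟨c * c', d * c', ?_⟩
    simp only [add_lie, smul_lie, lie_smul]
    module
  exact ⟨a1, a2, m1, m2, s1, s2, s3⟩

theorem IsFundamentalGNLA.finrank_two_le (hg : IsFundamentalGNLA g)
    (h1 : Module.finrank ℝ (g 1) = 2) : Module.finrank ℝ (g 2) ≤ 1 := by
  have := hg.finite
  obtain ⟨a1, a2, -, -, -, s2, -⟩ := hg.exists_generators h1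
  refine (Submodule.finrank_mono s2).trans ((finrank_span_le_card _).trans ?_)
  simp

theorem IsFundamentalGNLA.finrank_three_le (hg : IsFundamentalGNLA g)
    (h1 : Module.finrank ℝ (g 1) = 2) : Module.finrank ℝ (g 3) ≤ 2 := by
  classical
  have := hg.finite
  obtain ⟨a1, a2, -, -, -, -, s3⟩ := hg.exists_generators h1
  refine (Submodule.finrank_mono s3).trans ((finrank_span_le_card _).trans ?_)
  rw [Set.toFinset_insert, Set.toFinset_singleton]
  exact Finset.card_le_two

/-- Coordinates in which the bracket is that of the free nilpotent Lie algebra. -/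
theorem IsFundamentalGNLA.exists_free_coordinates (hg : IsFundamentalGNLA g)
    (h1 : Module.finrank ℝ (g 1) = 2) (h2 : Module.finrank ℝ (g 2) = 1)
    (h3 : Module.finrank ℝ (g 3) = 2) (hμ : ∀ i, 3 < i → g i = ⊥) :
    ∃ e : EuclideanSpace ℝ (Fin 5) ≃ₗ[ℝ] L, (∀ x v, ⁅e x, e v⁆ = e (freeBracket x v)) ∧
      ∀ v, e v ∈ g 1 ↔ v 2 = 0 ∧ v 3 = 0 ∧ v 4 = 0 := by
  have hfin := hg.finite
  obtain ⟨a1, a2, m1, m2, s1, s2, s3⟩ := hg.exists_generators h1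
  set a3 : L := ⁅a1, a2⁆ with ha3
  set a4 : L := ⁅a1, a3⁆ with ha4
  set a5 : L := ⁅a2, a3⁆ with ha5
  have m3 : a3 ∈ g 2 := hg.lie_mem 1 1 _ _ m1 m2
  have m4 : a4 ∈ g 3 := hg.lie_mem 1 2 _ _ m1 m3
  have m5 : a5 ∈ g 3 := hg.lie_mem 1 2 _ _ m2 m3
  have h21 : ⁅a2, a1⁆ = -a3 := by rw [ha3, lie_skew]
  have h31 : ⁅a3, a1⁆ = -a4 := by rw [ha4, lie_skew]
  have h32 : ⁅a3, a2⁆ = -a5 := by rw [ha5, lie_skew]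
  have zero_of : ∀ {i}, 3 < i → ∀ x ∈ g i, x = 0 := fun hi x hx => by
    rw [hμ _ hi] at hx; exact hx
  -- The generators and their iterated brackets span, and there are exactly `dim L = 5` of them.
  let b : Fin 5 → L := ![a1, a2, a3, a4, a5]
  have hb : ⊤ ≤ Submodule.span ℝ (Set.range b) := by
    have hm : ∀ i, b i ∈ Submodule.span ℝ (Set.range b) := fun i =>
      Submodule.subset_span ⟨i, rfl⟩
    rw [← hg.gradedFlag_eq_top hμ, gradedFlag_succ, gradedFlag_succ, hg.gradedFlag_one]
    refine sup_le (sup_le ?_ (s2.trans ?_)) (s3.trans ?_)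
    · intro x hx
      obtain ⟨c, d, rfl⟩ := s1 x hx
      exact add_mem (Submodule.smul_mem _ c (hm 0)) (Submodule.smul_mem _ d (hm 1))
    · exact Submodule.span_le.2 (Set.singleton_subset_iff.2 (hm 2))
    · exact Submodule.span_le.2 (Set.pair_subset (hm 3) (hm 4))
  let B : Module.Basis (Fin 5) ℝ L := basisOfTopLeSpanOfCardEqFinrank b hb
    (by rw [hg.finrank_eq_of_growth h1 h2 h3 hμ]; simp)
  let e : EuclideanSpace ℝ (Fin 5) ≃ₗ[ℝ] L := (WithLp.linearEquiv 2 ℝ (Fin 5 → ℝ)).trans B.equivFun.symm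
  have he : ∀ x : EuclideanSpace ℝ (Fin 5),
      e x = x 0 • a1 + x 1 • a2 + x 2 • a3 + x 3 • a4 + x 4 • a5 := fun x => by
    have : e x = ∑ i, x i • B i := B.equivFun_symm_apply _
    rw [this, coe_basisOfTopLeSpanOfCardEqFinrank]
    simp [Fin.sum_univ_five, b]
  have z4 : ∀ i, ∀ x ∈ g (i + 1), ⁅x, a4⁆ = 0 := fun i x hx =>
    zero_of (by omega) _ (hg.lie_mem (i + 1) 3 x a4 hx m4)
  have z5 : ∀ i, ∀ x ∈ g (i + 1), ⁅x, a5⁆ = 0 := fun i x hx =>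
    zero_of (by omega) _ (hg.lie_mem (i + 1) 3 x a5 hx m5)
  have z14 := z4 0 _ m1
  have z24 := z4 0 _ m2
  have z34 := z4 1 _ m3
  have z15 := z5 0 _ m1
  have z25 := z5 0 _ m2
  have z35 := z5 1 _ m3
  have z45 := z5 2 _ m4
  have sk : ∀ {x y : L}, ⁅x, y⁆ = 0 → ⁅y, x⁆ = 0 := fun {x y} h => by
    rw [← lie_skew, h, neg_zero]
  refine ⟨e, fun x v => ?_, fun v => ⟨fun hv => ?_, fun hv => ?_⟩⟩
  · rw [he, he, he]
    simp only [add_lie, lie_add, smul_lie, lie_smul, lie_self, h21, h31, h32, ← ha3, ← ha4, ← ha5,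
      z14, z24, z34, z15, z25, z35, z45, sk z14, sk z24, sk z34, sk z15, sk z25, sk z35, sk z45]
    simp [freeBracket]
    module
  · obtain ⟨c, d, hcd⟩ := s1 _ hv
    have : v = !₂[c, d, 0, 0, 0] := e.injective (by rw [hcd, he]; simp)
    rw [this]; simp
  · rw [he, hv.1, hv.2.1, hv.2.2]
    simpa using add_mem (Submodule.smul_mem _ (v 0) m1) (Submodule.smul_mem _ (v 1) m2)

theorem maurerCartan_free (e : EuclideanSpace ℝ (Fin 5) ≃ₗ[ℝ] L) (hfin : Module.finrank ℝ L = 5)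
    (hbr : ∀ x v, ⁅e x, e v⁆ = e (freeBracket x v)) (x v : EuclideanSpace ℝ (Fin 5)) :
    maurerCartan (e x) (e v) =
      e (v - (1 / 2 : ℝ) • freeBracket x v + (1 / 6 : ℝ) • freeBracket x (freeBracket x v)) := by
  -- Of the five terms of the series only `1 - ad/2 + ad²/6` survives.
  have h3 : freeBracket x (freeBracket x (freeBracket x v)) = 0 := by
    ext i; fin_cases i <;> simp [freeBracket]
  simp only [maurerCartan, hfin, Finset.sum_range_succ, Finset.sum_range_zero, LinearMap.add_apply,
    LinearMap.smul_apply, pow_succ', pow_zero, Module.End.mul_apply, LieAlgebra.ad_apply, hbr,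
    Module.End.one_apply, h3, map_zero, smul_zero, add_zero, zero_add, map_add, map_sub, map_smul]
  norm_num [Nat.factorial]
  module

theorem carries_hilbertCartanChart (hg : IsFundamentalGNLA g) (e : EuclideanSpace ℝ (Fin 5) ≃ₗ[ℝ] L)
    (h1 : Module.finrank ℝ (g 1) = 2) (h2 : Module.finrank ℝ (g 2) = 1)
    (h3 : Module.finrank ℝ (g 3) = 2) (hμ : ∀ i, 3 < i → g i = ⊥) :
    ∃ Φ : EuclideanSpace ℝ (Fin 5) ≃ₜ EuclideanSpace ℝ (Fin 5),
      Carries (E := EuclideanSpace ℝ (Fin 5)) (E' := EuclideanSpace ℝ (Fin 5)) Φ.toOpenPartialHomeomorph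
      (standardDistribution g e) hilbertCartan := by
  obtain ⟨e₀, hbr, hmem⟩ := hg.exists_free_coordinates h1 h2 h3 hμ
  have hfin := hg.finrank_eq_of_growth h1 h2 h3 hμ
  -- The given coordinates `e` are arbitrary, so first change linearly to those adapted to the
  -- bracket basis.
  let A : EuclideanSpace ℝ (Fin 5) ≃L[ℝ] EuclideanSpace ℝ (Fin 5) := (e.trans e₀.symm).toContinuousLinearEquiv
  have hA : ∀ x, e₀ (A x) = e x := fun x => e₀.apply_symm_apply _
  refine ⟨A.toHomeomorph.trans hilbertCartanChart, ?_⟩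
  refine carries_of_homeomorph (A.toHomeomorph.trans hilbertCartanChart)
    (contDiff_hilbertCartanChart.comp A.contDiff)
    (A.symm.contDiff.comp contDiff_hilbertCartanChart_symm) fun x v => ?_
  have hfd : fderiv ℝ (A.toHomeomorph.trans hilbertCartanChart) x v =
      fderiv ℝ hilbertCartanChart (A x) (A v) := by
    have : HasFDerivAt (hilbertCartanChart ∘ A)
        ((fderiv ℝ hilbertCartanChart (A x)).comp (A : EuclideanSpace ℝ (Fin 5) →L[ℝ] EuclideanSpace ℝ (Fin 5))) x :=
      (contDiff_hilbertCartanChart.differentiable (by simp) _).hasFDerivAt.comp x A.hasFDerivAt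
    exact congrArg (fun T : EuclideanSpace ℝ (Fin 5) →L[ℝ] EuclideanSpace ℝ (Fin 5) => T v) this.fderiv
  have hstd : v ∈ (standardDistribution g e x : Submodule ℝ (EuclideanSpace ℝ (Fin 5))) ↔
      maurerCartan (e x) (e v) ∈ g 1 :=
    Iff.rfl
  refine hstd.trans (Iff.trans ?_
    ((iff_of_eq (congrArg (· ∈ (hilbertCartan (hilbertCartanChart (A x)) :
      Submodule ℝ (EuclideanSpace ℝ (Fin 5)))) hfd)).trans
      (mem_hilbertCartan _ _)).symm)
  rw [← hA x, ← hA v, maurerCartan_free e₀ hfin hbr, hmem, fderiv_hilbertCartanChart]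
  generalize A x = y
  generalize A v = w
  simp [freeBracket, hilbertCartanChart]
  -- With `θ₂, θ₃, θ₄` the last three components of the Maurer–Cartan form, the chart pulls the
  -- contact forms of `y`, `z`, `z_1` back to `-2θ₄ - 2 y₁ θ₂`, `θ₃` and `-θ₂`. The two systems thus
  -- have the same zeros.
  constructor
  · rintro ⟨k2, k3, k4⟩
    refine ⟨?_, ?_, ?_⟩
    · linear_combination (-2 : ℝ) * k4 - 2 * y 1 * k2
    · linear_combination k3
    · linear_combination -k2
  · rintro ⟨k1, k2, k3⟩
    refine ⟨?_, ?_, ?_⟩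
    · linear_combination -k3
    · linear_combination k2
    · linear_combination (-1 / 2 : ℝ) * k1 + y 1 * k3

end FreeNilpotent
-- The tower over the Hilbert–Cartan equation.
section Tower

/-- The quotient map by an ideal. -/
def idealQuotientMap {L : Type*} [LieRing L] [LieAlgebra ℝ L] (J : LieIdeal ℝ L) : L →ₗ⁅ℝ⁆ L ⧸ J :=
  { (LieSubmodule.Quotient.mk' J : L →ₗ[ℝ] L ⧸ J) with
    map_lie' := by
      intro x y
      exact LieSubmodule.Quotient.mk_bracket J x y }

theorem isFlatOn_standardDistribution {d : ℕ} {L : Type} [LieRing L] [LieAlgebra ℝ L]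
    {g : ℕ → Submodule ℝ L} (hg : IsFundamentalGNLA g) (e : EuclideanSpace ℝ (Fin d) ≃ₗ[ℝ] L)
    (W : Set (EuclideanSpace ℝ (Fin d))) : IsFlatOn (standardDistribution g e) W :=
  ⟨L, _, _, g, e, hg, fun _ _ => locallyEquivalentAt_iff.2 ⟨_, Set.mem_univ _, carries_refl _⟩⟩

/-- Induction on a bound for the depth. The equivalence `Φ` is global, so that the next projection
is defined and onto on all of Euclidean space. It is nontrivial only at the bottom, where the tower
must start with `hilbertCartan` itself. -/
theorem exists_isSuccessiveExtension (n : ℕ) :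
    ∀ (d : ℕ) (L : Type) [LieRing L] [LieAlgebra ℝ L] (g : ℕ → Submodule ℝ L)
      (e : EuclideanSpace ℝ (Fin d) ≃ₗ[ℝ] L), IsFundamentalGNLA g →
      Module.finrank ℝ (g 1) = 2 → Module.finrank ℝ (g 2) = 1 → Module.finrank ℝ (g 3) = 2 →
      (∀ i, n + 3 < i → g i = ⊥) →
      ∃ (Δ : ∀ x : EuclideanSpace ℝ (Fin d),
          Submodule ℝ (TangentSpace 𝓘(ℝ, EuclideanSpace ℝ (Fin d)) x))
        (Φ : EuclideanSpace ℝ (Fin d) ≃ₜ EuclideanSpace ℝ (Fin d)),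
        IsSuccessiveExtension d Δ ∧ Carries (E := EuclideanSpace ℝ (Fin d))
          (E' := EuclideanSpace ℝ (Fin d)) Φ.toOpenPartialHomeomorph (standardDistribution g e) Δ := by
  induction n with
  | zero =>
    intro d L _ _ g e hg h1 h2 h3 hμ
    simp only [zero_add] at hμ
    have hd : d = 5 := by
      have := e.finrank_eq
      rwa [hg.finrank_eq_of_growth h1 h2 h3 hμ, finrank_euclideanSpace_fin] at this
    subst hd
    obtain ⟨Φ, hΦ⟩ := carries_hilbertCartanChart hg e h1 h2 h3 hμ
    exact ⟨hilbertCartan, Φ, .base, hΦ⟩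
  | succ n ih =>
    intro d L _ _ g e hg h1 h2 h3 hμ
    -- The bound need not be attained; an empty component would give fibres of dimension zero, so it
    -- is skipped.
    by_cases hbot : g (n + 1 + 3) = ⊥
    · refine ih d L g e hg h1 h2 h3 fun i hi => ?_
      rcases eq_or_ne i (n + 1 + 3) with rfl | hne
      · exact hbot
      · exact hμ i (by omega)
    have hfin := hg.finite
    let J := hg.bottomIdeal (n + 1 + 3) hμ
    let f : L →ₗ⁅ℝ⁆ L ⧸ J := idealQuotientMap J
    have hf : Function.Surjective f := LieSubmodule.Quotient.surjective_mk' J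
    have hker : ∀ x, f x = 0 ↔ x ∈ g (n + 1 + 3) := fun x => LieSubmodule.Quotient.mk_eq_zero' (N := J)
    have hg' := hg.map f hf hker
    -- The quotient map is injective on all components above the lowest one, so the dimensions 2, 1,
    -- 2 persist.
    have hrank : ∀ i, i < n + 1 + 3 →
        Module.finrank ℝ ((g i).map f.toLinearMap) = Module.finrank ℝ (g i) := by
      intro i hi
      rw [← LinearMap.range_domRestrict]
      refine LinearMap.finrank_range_of_inj ((injective_iff_map_eq_zero _).2 fun x hx => ?_)
      have h0 : (x : L) ∈ g (n + 1 + 3) := (hker x).1 hx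
      exact Subtype.ext (Submodule.disjoint_def.1 (hg.disjoint_gradedFlag hi) x h0
        (le_gradedFlag le_rfl x.2))
    have hfin' := hg'.finite
    let e' : EuclideanSpace ℝ (Fin (Module.finrank ℝ (L ⧸ J))) ≃ₗ[ℝ] L ⧸ J :=
      LinearEquiv.ofFinrankEq _ _ (by simp)
    have hμ' : ∀ i, n + 3 < i → (g i).map f.toLinearMap = ⊥ := by
      intro i hi
      rcases eq_or_ne i (n + 1 + 3) with rfl | hne
      · rw [eq_bot_iff]
        rintro _ ⟨x, hx, rfl⟩
        exact (hker x).2 hx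
      · rw [hμ i (by omega), Submodule.map_bot]
    obtain ⟨Δ, Φ, hΔ, hΦ⟩ := ih _ (L ⧸ J) (fun i => (g i).map f.toLinearMap) e' hg'
      ((hrank 1 (by omega)).trans h1) ((hrank 2 (by omega)).trans h2)
      ((hrank 3 (by omega)).trans h3) hμ'
    have hdim : Module.finrank ℝ (L ⧸ J) < d := by
      have h4 := e.finrank_eq
      rw [finrank_euclideanSpace_fin] at h4
      rw [h4]
      have h5 := LinearMap.finrank_range_add_finrank_ker f.toLinearMap
      rw [LinearMap.range_eq_top.2 hf, finrank_top] at h5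
      have h6 : LinearMap.ker f.toLinearMap = g (n + 1 + 3) := by
        ext x; exact hker x
      have h7 : 0 < Module.finrank ℝ (g (n + 1 + 3)) :=
        Submodule.one_le_finrank_iff.2 hbot
      rw [h6] at h5
      omega
    refine ⟨standardDistribution g e, Homeomorph.refl _, ?_, carries_refl _⟩
    have hpure := hasPureGrading_comp_coordHom hg hg' hf (by omega) hker e e' hΦ
    exact .step (Φ ∘ coordHom f e e') (n + 1 + 3) hΔ hdim
      (isDistribution_standardDistribution hg e h1) (isFlatOn_standardDistribution hg e _)
      (isIntegrableExtension_comp_coordHom hg hg' hf (fun _ => rfl) (by omega) hker e e' hΦ)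
      (completelyNonholonomic_standardDistribution hg e) (by omega) hpure

/-- A flat distribution whose growth vector at one point is at least `(2, 1, 2, …)` arises from
the Hilbert-Cartan equation. -/
theorem arisesFromHilbertCartanOn_of_isFlatOn {d : ℕ} {M : Type*} [TopologicalSpace M]
    [ChartedSpace (EuclideanSpace ℝ (Fin d)) M] [IsManifold 𝓘(ℝ, EuclideanSpace ℝ (Fin d)) ∞ M]
    {Δ : ∀ x : M, Submodule ℝ (TangentSpace 𝓘(ℝ, EuclideanSpace ℝ (Fin d)) x)} {W : Set M}
    (hflat : IsFlatOn Δ W)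
    (hgrowth : ∀ p ∈ W, Module.finrank ℝ (weakFlag Δ 1 p) = 2 ∧
      3 ≤ Module.finrank ℝ (weakFlag Δ 2 p) ∧ 5 ≤ Module.finrank ℝ (weakFlag Δ 3 p)) :
    ArisesFromHilbertCartanOn Δ W := by
  -- Without a point the growth condition says nothing about the algebra, but then there is nothing
  -- to match and any tower serves.
  rcases W.eq_empty_or_nonempty with rfl | ⟨p, hp⟩
  · exact ⟨5, hilbertCartan, .base, fun p hp => hp.elim⟩
  obtain ⟨L, _, _, g, e, hg, hloc⟩ := hflat
  have hrank : ∀ k, Module.finrank ℝ (gradedFlag g k) = Module.finrank ℝ (weakFlag Δ k p) := by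
    intro k
    obtain ⟨φ, hpφ, hφ⟩ := locallyEquivalentAt_iff.1 (hloc p hp)
    rw [← hφ.finrank_weakFlag_eq k hpφ]
    exact (finrank_weakFlag_standardDistribution hg e k (φ p)).symm
  obtain ⟨g1, g2, g3⟩ := hgrowth p hp
  rw [← hrank] at g1 g2 g3
  have e3 : Module.finrank ℝ (gradedFlag g 3) =
      Module.finrank ℝ (gradedFlag g 2) + Module.finrank ℝ (g 3) := hg.finrank_gradedFlag_succ 2
  have e2 : Module.finrank ℝ (gradedFlag g 2) =
      Module.finrank ℝ (gradedFlag g 1) + Module.finrank ℝ (g 2) := hg.finrank_gradedFlag_succ 1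
  have h1 : Module.finrank ℝ (g 1) = 2 := by rwa [hg.gradedFlag_one] at g1
  -- These upper bounds turn the assumed lower bounds on the flag into the exact dimensions 1 and 2.
  have b2 := hg.finrank_two_le h1
  have b3 := hg.finrank_three_le h1
  obtain ⟨μ, hμ⟩ := hg.exists_eq_bot
  obtain ⟨Δ', Φ, hΔ', hΦ⟩ := exists_isSuccessiveExtension μ d L g e hg h1 (by omega) (by omega)
    fun i hi => hμ i (by omega)
  refine ⟨d, Δ', hΔ', fun q hq => ?_⟩
  obtain ⟨φ, hqφ, hφ⟩ := locallyEquivalentAt_iff.1 (hloc q hq)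
  refine locallyEquivalentAt_iff.2 ⟨φ.trans Φ.toOpenPartialHomeomorph, ?_, hφ.trans hΦ⟩
  rw [OpenPartialHomeomorph.trans_source]
  exact ⟨hqφ, trivial⟩

end Tower
-- The growth vector of a non-degenerate Monge equation.
section Growth

variable {E : Type*} [NormedAddCommGroup E] [NormedSpace ℝ E]

theorem lieBracket_mem_weakFlag {Δ : ∀ x : E, Submodule ℝ (TangentSpace 𝓘(ℝ, E) x)} {W : Set E}
    (hW : IsOpen W) {k : ℕ} {X Y : E → E} (hX : ContDiffOn ℝ ∞ X W) (hY : ContDiffOn ℝ ∞ Y W)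
    (hXΔ : ∀ q ∈ W, X q ∈ Δ q) (hYΔ : ∀ q ∈ W, Y q ∈ weakFlag Δ (k + 1) q) {p : E} (hp : p ∈ W) :
    VectorField.lieBracket ℝ X Y p ∈ weakFlag Δ (k + 2) p := by
  refine (le_sup_right : _ ≤ weakFlag Δ (k + 2) p) (Submodule.subset_span ?_)
  exact ⟨X, Y, ⟨W, hW, hp, contMDiffOn_vectorSpace_iff_contDiffOn.2 hX, hXΔ⟩,
    ⟨W, hW, hp, contMDiffOn_vectorSpace_iff_contDiffOn.2 hY, hYΔ⟩,
    (mlieBracket_eq_lieBracket X Y p).symm⟩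

theorem card_le_finrank_of_linearIndependent [FiniteDimensional ℝ E] {r : ℕ} {v : Fin r → E}
    (hv : LinearIndependent ℝ v) {S : Submodule ℝ E} (hS : ∀ i, v i ∈ S) :
    r ≤ Module.finrank ℝ S := by
  have h1 := finrank_span_eq_card hv
  rw [Fintype.card_fin] at h1
  rw [← h1]
  exact Submodule.finrank_mono (Submodule.span_le.2 (Set.range_subset_iff.2 hS))

variable {N : ℕ}

theorem totalDerivative_zero (G : EuclideanSpace ℝ (Fin (N + 2)) → Fin N → ℝ)
    (p : EuclideanSpace ℝ (Fin (N + 2))) : totalDerivative G p 0 = 1 := rfl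

theorem totalDerivative_last (G : EuclideanSpace ℝ (Fin (N + 2)) → Fin N → ℝ)
    (p : EuclideanSpace ℝ (Fin (N + 2))) : totalDerivative G p (Fin.last (N + 1)) = 0 := by
  rw [← Fin.succ_last]
  simp [totalDerivative]

theorem totalDerivative_castSucc_succ (G : EuclideanSpace ℝ (Fin (N + 2)) → Fin N → ℝ)
    (p : EuclideanSpace ℝ (Fin (N + 2))) (i : Fin N) :
    totalDerivative G p i.castSucc.succ = G p i := by
  simp [totalDerivative]

theorem contDiffOn_totalDerivative {G : EuclideanSpace ℝ (Fin (N + 2)) → Fin N → ℝ}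
    {W : Set (EuclideanSpace ℝ (Fin (N + 2)))} (hG : ContDiffOn ℝ ∞ G W) :
    ContDiffOn ℝ ∞ (totalDerivative G) W := by
  rw [contDiffOn_euclidean]
  intro j
  induction j using Fin.cases with
  | zero => simpa only [totalDerivative_zero] using contDiffOn_const
  | succ j =>
    induction j using Fin.lastCases with
    | last => simpa only [Fin.succ_last, totalDerivative_last] using contDiffOn_const
    | cast j =>
      simp only [totalDerivative_castSucc_succ]
      exact contDiffOn_pi.1 hG j

theorem fderiv_euclidean_apply {ι : Type*} [Fintype ι] {X : E → EuclideanSpace ℝ ι} {p : E}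
    (hX : DifferentiableAt ℝ X p) (v : E) (j : ι) :
    fderiv ℝ X p v j = fderiv ℝ (fun q => X q j) p v := by
  have h : HasFDerivAt (fun q => X q j)
      ((EuclideanSpace.proj j : EuclideanSpace ℝ ι →L[ℝ] ℝ).comp (fderiv ℝ X p)) p :=
    (EuclideanSpace.proj j : EuclideanSpace ℝ ι →L[ℝ] ℝ).hasFDerivAt.comp p hX.hasFDerivAt
  rw [h.fderiv]; rfl

theorem fderiv_euclidean_coord {ι : Type*} [Fintype ι] (p v : EuclideanSpace ℝ ι) (j : ι) :
    fderiv ℝ (fun q : EuclideanSpace ℝ ι => q j) p v = v j :=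
  congrArg (fun T : EuclideanSpace ℝ ι →L[ℝ] ℝ => T v)
    (EuclideanSpace.proj j : EuclideanSpace ℝ ι →L[ℝ] ℝ).fderiv

/-- With `X = D_x`, `V = ∂/∂z_n` and `Z = [V, X]`, the five vectors `X, V, Z, [X, Z], [V, Z]` are
independent. Non-degeneracy enters only through `[V, Z]`, whose `y_(m-1)` component is the second
derivative of `F` in `z_n`. -/
theorem growth_mongeDistribution {m n : ℕ} {W : Set (EuclideanSpace ℝ (Fin (m + n + 2)))}
    {F : EuclideanSpace ℝ (Fin (m + n + 2)) → ℝ} (hm : 0 < m) (hn : 2 ≤ n)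
    (hW : IsOpen W) (hF : ContDiffOn ℝ ∞ F W)
    (hnd : ∀ p ∈ W, fderiv ℝ (fun q => fderiv ℝ F q (lastVector (m + n))) p (lastVector (m + n)) ≠ 0)
    {p : EuclideanSpace ℝ (Fin (m + n + 2))} (hp : p ∈ W) :
    Module.finrank ℝ (weakFlag (mongeDistribution m n F) 1 p) = 2 ∧
      3 ≤ Module.finrank ℝ (weakFlag (mongeDistribution m n F) 2 p) ∧
      5 ≤ Module.finrank ℝ (weakFlag (mongeDistribution m n F) 3 p) := by
  set G : EuclideanSpace ℝ (Fin (m + n + 2)) → Fin (m + n) → ℝ :=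
    fun p i => if i.val + 1 = m then F p else p i.succ.succ with hGdef
  set X := totalDerivative G with hXdef
  set V := lastVector (m + n) with hVdef
  set Δ := mongeDistribution m n F
  have hG : ContDiffOn ℝ ∞ G W := by
    rw [contDiffOn_pi]
    intro i
    by_cases hi : i.val + 1 = m
    · simpa only [hGdef, hi, if_true] using hF
    · simp only [hGdef, hi, if_false]
      exact (EuclideanSpace.proj i.succ.succ : EuclideanSpace ℝ (Fin (m + n + 2)) →L[ℝ] ℝ).contDiff.contDiffOn
  have hX : ContDiffOn ℝ ∞ X W := contDiffOn_totalDerivative hG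
  have hV : ContDiffOn ℝ ∞ (fun _ : EuclideanSpace ℝ (Fin (m + n + 2)) => V) W := contDiffOn_const
  let Z : EuclideanSpace ℝ (Fin (m + n + 2)) → EuclideanSpace ℝ (Fin (m + n + 2)) :=
    fun q => fderiv ℝ X q V
  have hZ : ContDiffOn ℝ ∞ Z W := (hX.fderiv_of_isOpen hW (by simp)).clm_apply contDiffOn_const
  have hXΔ : ∀ q, X q ∈ Δ q := fun q =>
    (Submodule.subset_span (Set.mem_insert _ _) : X q ∈ Submodule.span ℝ {X q, V})
  have hVΔ : ∀ q, V ∈ Δ q := fun q =>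
    (Submodule.subset_span (Set.mem_insert_of_mem _ rfl) : V ∈ Submodule.span ℝ {X q, V})
  have hbr : ∀ Y : EuclideanSpace ℝ (Fin (m + n + 2)) → EuclideanSpace ℝ (Fin (m + n + 2)), ∀ q,
      VectorField.lieBracket ℝ (fun _ => V) Y q = fderiv ℝ Y q V := fun Y q => by
    simp [VectorField.lieBracket]
  have hZΔ : ∀ q ∈ W, Z q ∈ weakFlag Δ 2 q := fun q hq => by
    have := lieBracket_mem_weakFlag (k := 0) hW hV hX (fun q _ => hVΔ q) (fun q _ => hXΔ q) hq
    rwa [hbr] at this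
  have hAΔ : fderiv ℝ Z p V ∈ weakFlag Δ 3 p := by
    have := lieBracket_mem_weakFlag (k := 1) hW hV hZ (fun q _ => hVΔ q) hZΔ hp
    rwa [hbr] at this
  have hCΔ : fderiv ℝ Z p (X p) - fderiv ℝ X p (Z p) ∈ weakFlag Δ 3 p :=
    lieBracket_mem_weakFlag (k := 1) hW hX hZ (fun q _ => hXΔ q) hZΔ hp
  have hXd : ∀ q ∈ W, DifferentiableAt ℝ X q := fun q hq =>
    (hX.contDiffAt (hW.mem_nhds hq)).differentiableAt (by simp)
  have hZd : DifferentiableAt ℝ Z p := (hZ.contDiffAt (hW.mem_nhds hp)).differentiableAt (by simp)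
  -- Positions of `z_n`, `z_(n-1)`, `z_(n-2)` and `y_(m-1)`. The third is a `z`-coordinate, distinct
  -- from `y_(m-1)`, because `n ≥ 2`.
  let jL : Fin (m + n + 2) := Fin.last (m + n + 1)
  let jN : Fin (m + n + 2) := ⟨m + n, by omega⟩
  let jK : Fin (m + n + 2) := ⟨m + n - 1, by omega⟩
  let jm : Fin (m + n + 2) := ⟨m, by omega⟩
  have X0 : ∀ q, X q 0 = 1 := fun q => totalDerivative_zero G q
  have XL : ∀ q, X q jL = 0 := fun q => totalDerivative_last G q
  have XN : ∀ q, X q jN = q jL := fun q => by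
    have h1 : jN = (⟨m + n - 1, by omega⟩ : Fin (m + n)).castSucc.succ := by
      ext; simp [jN]; omega
    have h2 : (⟨m + n - 1, by omega⟩ : Fin (m + n)).succ.succ = jL := by
      ext; simp [jL]; omega
    rw [h1, hXdef, totalDerivative_castSucc_succ, ← h2]
    exact if_neg (by simp; omega)
  have XK : ∀ q, X q jK = q jN := fun q => by
    have h1 : jK = (⟨m + n - 2, by omega⟩ : Fin (m + n)).castSucc.succ := by
      ext; simp [jK]; omega
    have h2 : (⟨m + n - 2, by omega⟩ : Fin (m + n)).succ.succ = jN := by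
      ext; simp [jN]; omega
    rw [h1, hXdef, totalDerivative_castSucc_succ, ← h2]
    exact if_neg (by simp; omega)
  have Xm : ∀ q, X q jm = F q := fun q => by
    have h1 : jm = (⟨m - 1, by omega⟩ : Fin (m + n)).castSucc.succ := by
      ext; simp [jm]; omega
    rw [h1, hXdef, totalDerivative_castSucc_succ]
    exact if_pos (by simp; omega)
  have Vj : ∀ j, V j = if j = jL then 1 else 0 := fun j => by
    simp [hVdef, lastVector, jL]
  have VL : V jL = 1 := by simp [Vj]
  have V0 : V 0 = 0 := by rw [Vj, if_neg]; simp [jL, Fin.ext_iff]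
  have VN : V jN = 0 := by rw [Vj, if_neg]; simp [jL, jN, Fin.ext_iff]
  have VK : V jK = 0 := by rw [Vj, if_neg]; simp [jL, jK, Fin.ext_iff]
  have Vm : V jm = 0 := by rw [Vj, if_neg]; simp [jL, jm, Fin.ext_iff]; omega
  have dX0 : ∀ q ∈ W, ∀ v, fderiv ℝ X q v 0 = 0 := fun q hq v => by
    rw [fderiv_euclidean_apply (hXd q hq)]; simp [X0]
  have dXL : ∀ q ∈ W, ∀ v, fderiv ℝ X q v jL = 0 := fun q hq v => by
    rw [fderiv_euclidean_apply (hXd q hq)]; simp [XL]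
  have dXN : ∀ q ∈ W, ∀ v, fderiv ℝ X q v jN = v jL := fun q hq v => by
    rw [fderiv_euclidean_apply (hXd q hq)]; simp only [XN, fderiv_euclidean_coord]
  have dXK : ∀ q ∈ W, ∀ v, fderiv ℝ X q v jK = v jN := fun q hq v => by
    rw [fderiv_euclidean_apply (hXd q hq)]; simp only [XK, fderiv_euclidean_coord]
  have dXm : ∀ q ∈ W, ∀ v, fderiv ℝ X q v jm = fderiv ℝ F q v := fun q hq v => by
    rw [fderiv_euclidean_apply (hXd q hq)]; simp only [Xm]
  have Z0 : ∀ q ∈ W, Z q 0 = 0 := fun q hq => dX0 q hq V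
  have ZL : ∀ q ∈ W, Z q jL = 0 := fun q hq => dXL q hq V
  have ZN : ∀ q ∈ W, Z q jN = 1 := fun q hq => (dXN q hq V).trans VL
  have ZK : ∀ q ∈ W, Z q jK = 0 := fun q hq => (dXK q hq V).trans VN
  have Zm : ∀ q ∈ W, Z q jm = fderiv ℝ F q V := fun q hq => dXm q hq V
  have dZ : ∀ (j : Fin (m + n + 2)) (f : EuclideanSpace ℝ (Fin (m + n + 2)) → ℝ),
      (∀ q ∈ W, Z q j = f q) → ∀ v, fderiv ℝ Z p v j = fderiv ℝ f p v := fun j f h v => by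
    rw [fderiv_euclidean_apply hZd]
    have : (fun q => Z q j) =ᶠ[𝓝 p] f := Filter.eventually_of_mem (hW.mem_nhds hp) h
    rw [this.fderiv_eq]
  have dZc : ∀ (j : Fin (m + n + 2)) (c : ℝ), (∀ q ∈ W, Z q j = c) →
      ∀ v, fderiv ℝ Z p v j = 0 := fun j c h v => by
    rw [dZ j (fun _ => c) h]; simp
  have hA : fderiv ℝ Z p V jm ≠ 0 := by
    rw [dZ jm _ Zm]
    exact hnd p hp
  -- The system is triangular: the components along `x, z_n, z_(n-1), z_(n-2), y_(m-1)` successively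
  -- force `c 0, …, c 4` to vanish. Along `z_(n-2)` the bracket `[X, Z]` has component -1.
  have hli : ∀ c : Fin 5 → ℝ, c 0 • X p + c 1 • V + c 2 • Z p
      + c 3 • (fderiv ℝ Z p (X p) - fderiv ℝ X p (Z p)) + c 4 • fderiv ℝ Z p V = 0 → ∀ i, c i = 0 := by
    intro c hc
    have key : ∀ j, c 0 * X p j + c 1 * V j + c 2 * Z p j
        + c 3 * (fderiv ℝ Z p (X p) j - fderiv ℝ X p (Z p) j) + c 4 * fderiv ℝ Z p V j = 0 :=
      fun j => by simpa using congrArg (fun w : EuclideanSpace ℝ (Fin (m + n + 2)) => w j) hc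
    have k0 := key 0
    rw [X0, V0, Z0 p hp, dZc 0 0 Z0, dX0 p hp, dZc 0 0 Z0] at k0
    have kL := key jL
    rw [XL, VL, ZL p hp, dZc jL 0 ZL, dXL p hp, dZc jL 0 ZL] at kL
    have kN := key jN
    rw [VN, ZN p hp, dZc jN 1 ZN, dXN p hp, ZL p hp, dZc jN 1 ZN] at kN
    have kK := key jK
    rw [VK, ZK p hp, dZc jK 0 ZK, dXK p hp, ZN p hp, dZc jK 0 ZK] at kK
    have km := key jm
    have c0 : c 0 = 0 := by linarith
    have c1 : c 1 = 0 := by linarith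
    have c2 : c 2 = 0 := by rw [c0] at kN; linarith
    have c3 : c 3 = 0 := by rw [c0] at kK; linarith
    have c4 : c 4 = 0 := by
      rw [c0, c1, c2, c3] at km
      have : c 4 * fderiv ℝ Z p V jm = 0 := by linarith
      exact (mul_eq_zero.1 this).resolve_right hA
    intro i
    fin_cases i <;> assumption
  have h1 : LinearIndependent ℝ ![X p, V] := by
    rw [Fintype.linearIndependent_iff]
    intro c hc i
    have := hli ![c 0, c 1, 0, 0, 0] (by simpa [Fin.sum_univ_two] using hc)
    fin_cases i
    · exact this 0
    · exact this 1
  have h2 : LinearIndependent ℝ ![X p, V, Z p] := by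
    rw [Fintype.linearIndependent_iff]
    intro c hc i
    have := hli ![c 0, c 1, c 2, 0, 0] (by simpa [Fin.sum_univ_three] using hc)
    fin_cases i
    · exact this 0
    · exact this 1
    · exact this 2
  have h3 : LinearIndependent ℝ ![X p, V, Z p, fderiv ℝ Z p (X p) - fderiv ℝ X p (Z p),
      fderiv ℝ Z p V] := by
    rw [Fintype.linearIndependent_iff]
    intro c hc
    exact hli c (by simpa [Fin.sum_univ_five] using hc)
  have m12 : weakFlag Δ 1 p ≤ weakFlag Δ 2 p := le_sup_left
  have m23 : weakFlag Δ 2 p ≤ weakFlag Δ 3 p := le_sup_left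
  refine ⟨?_, ?_, ?_⟩
  · have := finrank_span_eq_card h1
    rw [Fintype.card_fin] at this
    rw [show Set.range ![X p, V] = {X p, V} by simp [Set.pair_comm]] at this
    exact this
  · refine card_le_finrank_of_linearIndependent
      (S := (weakFlag Δ 2 p : Submodule ℝ (EuclideanSpace ℝ (Fin (m + n + 2))))) h2 fun i => ?_
    fin_cases i
    · exact m12 (hXΔ p)
    · exact m12 (hVΔ p)
    · exact hZΔ p hp
  · refine card_le_finrank_of_linearIndependent
      (S := (weakFlag Δ 3 p : Submodule ℝ (EuclideanSpace ℝ (Fin (m + n + 2))))) h3 fun i => ?_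
    fin_cases i
    · exact m23 (m12 (hXΔ p))
    · exact m23 (m12 (hVΔ p))
    · exact m23 (hZΔ p hp)
    · exact hCΔ
    · exact hAΔ

end Growth
end Monge

theorem theorem3 :
    -- an arbitrary flat rank 2 distribution with growth vector (2, 1, 2, ...) on a manifold
    (∀ (d : ℕ) (M : Type*) [TopologicalSpace M] [ChartedSpace (EuclideanSpace ℝ (Fin d)) M]
        [IsManifold 𝓘(ℝ, EuclideanSpace ℝ (Fin d)) ∞ M]
        (Δ : ∀ x : M, Submodule ℝ (TangentSpace 𝓘(ℝ, EuclideanSpace ℝ (Fin d)) x)),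
        Monge.IsDistribution Δ 2 → Monge.HasGrowthTwoOneTwoOn Δ Set.univ →
        Monge.IsFlatOn Δ Set.univ →
        Monge.ArisesFromHilbertCartanOn Δ Set.univ) ∧
    -- a flat non-degenerate Monge equation
    (∀ (m n : ℕ) (W : Set (EuclideanSpace ℝ (Fin (m + n + 2))))
        (F : EuclideanSpace ℝ (Fin (m + n + 2)) → ℝ),
        0 < m → m ≤ n → (m, n) ≠ (1, 1) → IsOpen W → ContDiffOn ℝ ∞ F W →
        (∀ p ∈ W, fderiv ℝ (fun q => fderiv ℝ F q (Monge.lastVector (m + n))) p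
          (Monge.lastVector (m + n)) ≠ 0) →
        Monge.IsFlatOn (Monge.mongeDistribution m n F) W →
        Monge.ArisesFromHilbertCartanOn (Monge.mongeDistribution m n F) W) ∧
    -- a flat underdetermined system of ODEs with growth vector (2, 1, 2, ...)
    (∀ (N : ℕ) (W : Set (EuclideanSpace ℝ (Fin (N + 2))))
        (G : EuclideanSpace ℝ (Fin (N + 2)) → Fin N → ℝ),
        IsOpen W → ContDiffOn ℝ ∞ G W →
        Monge.HasGrowthTwoOneTwoOn (Monge.odeDistribution G) W →
        Monge.IsFlatOn (Monge.odeDistribution G) W →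
        Monge.ArisesFromHilbertCartanOn (Monge.odeDistribution G) W) := by
  refine ⟨fun d M _ _ _ Δ _ hgrowth hflat => ?_, fun m n W F hm hmn hne hW hF hnd hflat => ?_,
    fun N W G _ _ hgrowth hflat => ?_⟩
  · refine Monge.arisesFromHilbertCartanOn_of_isFlatOn hflat fun p hp => ?_
    obtain ⟨h1, h2, h3⟩ := hgrowth p hp
    exact ⟨h1, h2.ge, h3.ge⟩
  -- If `n ≤ 1`, then `0 < m ≤ n` leaves only the excluded pair `(1, 1)`.
  · have hn : 2 ≤ n := by
      by_contra h
      exact hne (Prod.ext (by simp; omega) (by simp; omega))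
    exact Monge.arisesFromHilbertCartanOn_of_isFlatOn hflat fun p hp =>
      Monge.growth_mongeDistribution hm hn hW hF hnd hp
  · refine Monge.arisesFromHilbertCartanOn_of_isFlatOn hflat fun p hp => ?_
    obtain ⟨h1, h2, h3⟩ := hgrowth p hp
    exact ⟨h1, h2.ge, h3.ge⟩
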